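/- Let $r_1,r_2\ge 2$ be integers, let $x^{(1)}_1<\dots<x^{(1)}_{r_1}$ and $x^{(2)}_1<\dots<x^{(2)}_{r_2}$ be real numbers, and let $P$ be a probability measure on $\mathcal X=\{x^{(1)}_i\}\times\{x^{(2)}_j\}$ with probability array $\mathbf p=(p_{ij})$, $p_{ij}=P(\{(x^{(1)}_i,x^{(2)}_j)\})$. The support of an array $a\in\mathbb R^{r_1\times r_2}$ is $\mathrm{Supp}(a)=\{(i,j):a_{ij}\ne 0\}$; put $S=\mathrm{Supp}(\mathbf p)$. Let $\Gamma$ be the set of nonnegative arrays in $\mathbb R^{r_1\times r_2}$ with all row sums $1/r_1$ and all column sums $1/r_2$, and $\Gamma(S)=\{\gamma\in\Gamma:\mathrm{Supp}(\gamma)=S\}$. For probability arrays, $\mathcal I(q\|p)=\sum_{(i,j)\in \mathrm{Supp}(p)}q_{ij}\log(q_{ij}/p_{ij})$ (with $0\log 0=0$) if $\mathrm{Supp}(q)\subseteq \mathrm{Supp}(p)$, and $\mathcal I(q\|p)=\infty$ otherwise. Assume $\Gamma(S)\neq\emptyset$. The copula array $\gamma_{\mathbf p}$ of $\mathbf p$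 is the unique minimiser of $\mathcal I(\cdot\|\mathbf p)$ over $\Gamma$. Let $X_1,X_2,\dots$ be random vectors on a common probability space, each with law $P$ (not necessarily independent), and let $$\hat{\mathbf p}_n=\tfrac{n}{n+1}\mathbf p_n+\tfrac1{n+1}\mathbf q,\qquad p_{n;ij}=\tfrac1n\sum_{k=1}^n \mathbf 1\{X_k=(x^{(1)}_i,x^{(2)}_j)\},\qquad q_{ij}=\tfrac{1}{|S|}\mathbf 1\{(i,j)\in S\},$$ and let $\hat\gamma_n$ be the unique minimiser of $\mathcal I(\cdot\|\hat{\mathbf p}_n)$ over $\Gamma$. For $\gamma\in\Gamma$ define $$\Upsilon(\gamma)=\frac{12}{\sqrt{(r_1+1)(r_1-1)(r_2+1)(r_2-1)}}\sum_{i=1}^{r_1}\sum_{j=1}^{r_2} i\,j\,\gamma_{ij}-3\,\frac{\sqrt{(r_1+1)(r_2+1)}}{\sqrt{(r_1-1)(r_2-1)}},$$ and put $\Upsilon=\Upsilon(\gamma_{\mathbf p})$, $\hat\Upsilon_n=\Upsilon(\hat\gamma_n)$ and $\kappa=12/\sqrt{(r_1-1)(r_1+1)(r_2-1)(r_2+1)}$.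 Write $\underline a=\mathrm{vec}(a)\in\mathbb R^{r_1r_2}$ for the column-major vectorisation, and let $k=(1,\dots,r_2)^{\mathsf T}\otimes(1,\dots,r_1)^{\mathsf T}\in\mathbb R^{r_1r_2}$. (a) If $\hat{\mathbf p}_n\to\mathbf p$ in probability, then $\hat\Upsilon_n\to\Upsilon$ in probability; if $\hat{\mathbf p}_n\to\mathbf p$ almost surely, then $\hat\Upsilon_n\to\Upsilon$ almost surely. For (b) and (c), assume moreover that the space $\Delta^\circ(S)$ of arrays with support contained in $S$ and all row and column sums zero has dimension $d_\circ\ge1$. Take any basis of it, let $A$ be the $r_1r_2\times d_\circ$ matrix whose columns are the vectorised basis arrays, let $R$ be the $|S|\times r_1r_2$ matrix selecting the entries with position in $S$, and put $\tilde A=RA$, $G(v)=\tilde A^{\mathsf T}\,\mathrm{diag}(Rv)^{-1}\tilde A$, $$J=A\,G(\underline\gamma_{\mathbf p})^{-1}\tilde A^{\mathsf T}\,\mathrm{diag}(R\underline{\mathbf p})^{-1}R,\qquad \Sigma_\gamma=A\,G(\underline\gamma_{\mathbf p})^{-1}\,G(\underline{\mathbf p})\,G(\underline\gamma_{\mathbf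 p})^{-1}A^{\mathsf T}.$$ (b) If $\rho_n\to\infty$ are real numbers and $Z$ is a random vector in $\mathbb R^{r_1r_2}$ such that $\rho_n(\underline{\hat{\mathbf p}}_n-\underline{\mathbf p})\to Z$ in distribution, then $\rho_n(\hat\Upsilon_n-\Upsilon)\to\kappa\,k^{\mathsf T}JZ$ in distribution. (c) If $X_1,X_2,\dots$ are independent, then $\sqrt n(\underline{\hat{\mathbf p}}_n-\underline{\mathbf p})\to N(0,\mathrm{diag}(\underline{\mathbf p})-\underline{\mathbf p}\,\underline{\mathbf p}^{\mathsf T})$ in distribution, and $\sqrt n(\hat\Upsilon_n-\Upsilon)\to N(0,\sigma_\Upsilon^2)$ in distribution, where $\sigma_\Upsilon^2=\kappa^2\,k^{\mathsf T}\Sigma_\gamma k\ge 0$. -/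

import Mathlib

open MeasureTheory ProbabilityTheory Filter Topology Matrix

namespace DiscreteCopula

noncomputable section

/-- The support of an array: the positions of its nonzero entries. -/
def supp {r₁ r₂ : ℕ} (a : Matrix (Fin r₁) (Fin r₂) ℝ) : Finset (Fin r₁ × Fin r₂) :=
  letI := Classical.decPred fun i : Fin r₁ × Fin r₂ => a i.1 i.2 ≠ 0
  Finset.univ.filter fun i => a i.1 i.2 ≠ 0

/-- Probability arrays with no identically null row or column. -/
def probArrays (r₁ r₂ : ℕ) : Set (Matrix (Fin r₁) (Fin r₂) ℝ) :=
  {p | (∀ i j, p i j ∈ Set.Icc (0 : ℝ) 1) ∧ ∑ i, ∑ j, p i j = 1 ∧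
    (∀ i, 0 < ∑ j, p i j) ∧ ∀ j, 0 < ∑ i, p i j}

/-- The Fréchet class `Γ` of copula arrays: probability arrays with uniform margins. -/
def copulaArrays (r₁ r₂ : ℕ) : Set (Matrix (Fin r₁) (Fin r₂) ℝ) :=
  {γ | γ ∈ probArrays r₁ r₂ ∧ (∀ i, ∑ j, γ i j = 1 / (r₁ : ℝ)) ∧ ∀ j, ∑ i, γ i j = 1 / (r₂ : ℝ)}

/-- `Γ(S)`: the copula arrays with support exactly `S`. -/
def copulaArraysOn {r₁ r₂ : ℕ} (S : Finset (Fin r₁ × Fin r₂)) :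
    Set (Matrix (Fin r₁) (Fin r₂) ℝ) :=
  {γ | γ ∈ copulaArrays r₁ r₂ ∧ supp γ = S}

open Classical in
/-- The `I`-divergence (Kullback-Leibler divergence) of `q` with respect to `p`. In the sum,
`0 * log 0 = 0`. -/
def iDiv {r₁ r₂ : ℕ} (q p : Matrix (Fin r₁) (Fin r₂) ℝ) : EReal :=
  if supp q ⊆ supp p then
    ((∑ i ∈ supp p, q i.1 i.2 * Real.log (q i.1 i.2 / p i.1 i.2) : ℝ) : EReal)
  else ⊤

/-- `γ` minimises the `I`-divergence with respect to `p` over all copula arrays. -/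
def IsIProjection {r₁ r₂ : ℕ} (p γ : Matrix (Fin r₁) (Fin r₂) ℝ) : Prop :=
  γ ∈ copulaArrays r₁ r₂ ∧ ∀ γ' ∈ copulaArrays r₁ r₂, iDiv γ p ≤ iDiv γ' p

open Classical in
/-- The copula array of `p`: its `I`-projection on the copula arrays. The value `0` is used only
when there is no unique `I`-projection, which is excluded by `existsUnique_isIProjection` as soon as
some copula array has its support inside that of `p`. -/
def copulaArray {r₁ r₂ : ℕ} (p : Matrix (Fin r₁) (Fin r₂) ℝ) : Matrix (Fin r₁) (Fin r₂) ℝ :=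
  if h : ∃! γ, IsIProjection p γ then h.choose else 0

theorem mem_supp {r₁ r₂ : ℕ} {a : Matrix (Fin r₁) (Fin r₂) ℝ} {i : Fin r₁ × Fin r₂} :
    i ∈ supp a ↔ a i.1 i.2 ≠ 0 := by
  simp [supp]

theorem existsUnique_isIProjection {r₁ r₂ : ℕ} (p : Matrix (Fin r₁) (Fin r₂) ℝ)
    (h : ∃ γ ∈ copulaArrays r₁ r₂, supp γ ⊆ supp p) : ∃! γ, IsIProjection p γ := by
  obtain ⟨γ₀, hγ₀, hs₀⟩ := h
  have h01 : ∀ γ ∈ copulaArrays r₁ r₂, ∀ i j, 0 ≤ γ i j ∧ γ i j ≤ 1 := fun γ hγ => hγ.1.1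
  set φ : Fin r₁ × Fin r₂ → ℝ → ℝ := fun i x => x * Real.log x - x * Real.log (p i.1 i.2) with hφ
  set f : Matrix (Fin r₁) (Fin r₂) ℝ → ℝ := fun γ => ∑ i ∈ supp p, φ i (γ i.1 i.2) with hf
  have hdiv : ∀ γ, supp γ ⊆ supp p → iDiv γ p = (f γ : EReal) := by
    intro γ hγ
    rw [iDiv, if_pos hγ]
    congr 1
    refine Finset.sum_congr rfl fun i hi => ?_
    have hpi := mem_supp.1 hi
    by_cases h0 : γ i.1 i.2 = 0
    · simp [hφ, h0]
    · simp only [hφ]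
      rw [Real.log_div h0 hpi]
      ring
  have hdiv' : ∀ γ, ¬ supp γ ⊆ supp p → iDiv γ p = ⊤ := fun γ hγ => by rw [iDiv, if_neg hγ]
  have hsupp : ∀ γ : Matrix (Fin r₁) (Fin r₂) ℝ,
      supp γ ⊆ supp p ↔ ∀ i j, p i j = 0 → γ i j = 0 := by
    intro γ
    constructor
    · intro hs i j hpij
      by_contra hne
      exact mem_supp.1 (hs (mem_supp (i := (i, j)).2 hne)) hpij
    · intro hs i hi
      rw [mem_supp] at hi ⊢
      exact fun h0 => hi (hs _ _ h0)
  have hfc : Continuous f := by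
    refine continuous_finsetSum _ fun i _ => ?_
    have hc : Continuous fun γ : Matrix (Fin r₁) (Fin r₂) ℝ => γ i.1 i.2 :=
      continuous_id.matrix_elem _ _
    exact (Real.continuous_mul_log.comp hc).sub (hc.mul continuous_const)
  -- the minimum over the compact set of candidates
  set K : Set (Matrix (Fin r₁) (Fin r₂) ℝ) :=
    {γ | (∀ i j, 0 ≤ γ i j ∧ γ i j ≤ 1) ∧ (∑ i, ∑ j, γ i j = 1) ∧
      ((∀ i, ∑ j, γ i j = 1 / (r₁ : ℝ)) ∧ ∀ j, ∑ i, γ i j = 1 / (r₂ : ℝ)) ∧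
      ∀ i j, p i j = 0 → γ i j = 0} with hK
  have hpos₁ : ∀ i : Fin r₁, (0 : ℝ) < 1 / (r₁ : ℝ) := fun i => by
    have : 0 < r₁ := i.pos
    positivity
  have hpos₂ : ∀ i : Fin r₂, (0 : ℝ) < 1 / (r₂ : ℝ) := fun i => by
    have : 0 < r₂ := i.pos
    positivity
  have hKmem : ∀ γ, γ ∈ K ↔ γ ∈ copulaArrays r₁ r₂ ∧ supp γ ⊆ supp p := by
    intro γ
    rw [hsupp]
    constructor
    · rintro ⟨h1, h2, h3, h4⟩
      refine ⟨⟨⟨h1, h2, fun i => ?_, fun j => ?_⟩, h3⟩, h4⟩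
      · rw [h3.1 i]; exact hpos₁ i
      · rw [h3.2 j]; exact hpos₂ j
    · rintro ⟨⟨⟨h1, h2, _⟩, h3⟩, h4⟩
      exact ⟨h1, h2, h3, h4⟩
  have hKclosed : IsClosed K := by
    have hc : ∀ i j, Continuous fun γ : Matrix (Fin r₁) (Fin r₂) ℝ => γ i j :=
      fun i j => continuous_id.matrix_elem _ _
    have e1 : ∀ i, Continuous fun γ : Matrix (Fin r₁) (Fin r₂) ℝ => ∑ j, γ i j :=
      fun i => continuous_finsetSum _ fun j _ => hc i j
    have e2 : ∀ j, Continuous fun γ : Matrix (Fin r₁) (Fin r₂) ℝ => ∑ i, γ i j :=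
      fun j => continuous_finsetSum _ fun i _ => hc i j
    have e3 : Continuous fun γ : Matrix (Fin r₁) (Fin r₂) ℝ => ∑ i, ∑ j, γ i j :=
      continuous_finsetSum _ fun i _ => e1 i
    simp only [hK, Set.ofPred_and, Set.ofPred_forall]
    refine IsClosed.inter ?_ (IsClosed.inter ?_ (IsClosed.inter (IsClosed.inter ?_ ?_) ?_))
    · exact isClosed_iInter fun i => isClosed_iInter fun j =>
        (isClosed_le continuous_const (hc i j)).inter (isClosed_le (hc i j) continuous_const)
    · exact isClosed_eq e3 continuous_const
    · exact isClosed_iInter fun i => isClosed_eq (e1 i) continuous_const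
    · exact isClosed_iInter fun j => isClosed_eq (e2 j) continuous_const
    · exact isClosed_iInter fun i => isClosed_iInter fun j => isClosed_iInter fun _ =>
        isClosed_eq (hc i j) continuous_const
  have hKcompact : IsCompact K := by
    have hbox : IsCompact (Set.pi Set.univ fun _ : Fin r₁ =>
        Set.pi Set.univ fun _ : Fin r₂ => Set.Icc (0 : ℝ) 1) :=
      isCompact_univ_pi fun _ => isCompact_univ_pi fun _ => isCompact_Icc
    refine IsCompact.of_isClosed_subset hbox hKclosed ?_
    intro γ hγ i _ j _
    exact hγ.1 i j
  obtain ⟨γ, hγK, hγmin⟩ := hKcompact.exists_isMinOn ⟨γ₀, (hKmem _).2 ⟨hγ₀, hs₀⟩⟩ hfc.continuousOn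
  have hγ := (hKmem _).1 hγK
  refine ⟨γ, ⟨hγ.1, fun γ' hγ' => ?_⟩, fun γ' hγ' => ?_⟩
  · by_cases hs : supp γ' ⊆ supp p
    · rw [hdiv _ hγ.2, hdiv _ hs]
      exact_mod_cast hγmin ((hKmem _).2 ⟨hγ', hs⟩)
    · rw [hdiv' _ hs]
      exact le_top
  -- uniqueness by strict convexity
  · have hs' : supp γ' ⊆ supp p := by
      by_contra hs
      have := hγ'.2 γ hγ.1
      rw [hdiv' _ hs, hdiv _ hγ.2] at this
      exact absurd this (by simp)
    have hγ'K : γ' ∈ K := (hKmem _).2 ⟨hγ'.1, hs'⟩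
    have hle : f γ' ≤ f γ := by
      have := hγ'.2 γ hγ.1
      rw [hdiv _ hs', hdiv _ hγ.2] at this
      exact_mod_cast this
    by_contra hne
    obtain ⟨i₀, j₀, hij⟩ : ∃ i j, γ' i j ≠ γ i j := by
      by_contra hall
      push Not at hall
      exact hne (Matrix.ext hall)
    have hmK : (1 / 2 : ℝ) • γ' + (1 / 2 : ℝ) • γ ∈ K := by
      obtain ⟨a1, a2, ⟨a3, a4⟩, a5⟩ := hγ'K
      obtain ⟨b1, b2, ⟨b3, b4⟩, b5⟩ := hγK
      refine ⟨fun i j => ?_, ?_, ⟨fun i => ?_, fun j => ?_⟩, fun i j hp => ?_⟩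
      · simp only [Matrix.add_apply, Matrix.smul_apply, smul_eq_mul]
        constructor <;> linarith [a1 i j, b1 i j, (a1 i j).1, (b1 i j).1, (a1 i j).2, (b1 i j).2]
      · simp only [Matrix.add_apply, Matrix.smul_apply, smul_eq_mul, Finset.sum_add_distrib,
          ← Finset.mul_sum, a2, b2]
        norm_num
      · simp only [Matrix.add_apply, Matrix.smul_apply, smul_eq_mul, Finset.sum_add_distrib,
          ← Finset.mul_sum, a3, b3]
        ring
      · simp only [Matrix.add_apply, Matrix.smul_apply, smul_eq_mul, Finset.sum_add_distrib,
          ← Finset.mul_sum, a4, b4]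
        ring
      · simp [a5 i j hp, b5 i j hp]
    have hlt : f ((1 / 2 : ℝ) • γ' + (1 / 2 : ℝ) • γ) < (1 / 2) * f γ' + (1 / 2) * f γ := by
      simp only [hf, Finset.mul_sum, ← Finset.sum_add_distrib]
      have key : ∀ i : Fin r₁ × Fin r₂, γ' i.1 i.2 ≠ γ i.1 i.2 →
          φ i (((1 / 2 : ℝ) • γ' + (1 / 2 : ℝ) • γ) i.1 i.2) <
            1 / 2 * φ i (γ' i.1 i.2) + 1 / 2 * φ i (γ i.1 i.2) := by
        intro i hi
        have := Real.strictConvexOn_mul_log.2 (Set.mem_Ici.2 (hγ'K.1 i.1 i.2).1)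
          (Set.mem_Ici.2 (hγK.1 i.1 i.2).1) hi (by norm_num : (0 : ℝ) < 1 / 2)
          (by norm_num : (0 : ℝ) < 1 / 2) (by norm_num)
        simp only [smul_eq_mul] at this
        simp only [hφ, Matrix.add_apply, Matrix.smul_apply, smul_eq_mul]
        linarith
      refine Finset.sum_lt_sum (fun i _ => ?_) ⟨(i₀, j₀), ?_, key (i₀, j₀) hij⟩
      · by_cases hi : γ' i.1 i.2 = γ i.1 i.2
        · have : ((1 / 2 : ℝ) • γ' + (1 / 2 : ℝ) • γ) i.1 i.2 = γ i.1 i.2 := by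
            simp only [Matrix.add_apply, Matrix.smul_apply, smul_eq_mul, hi]
            ring
          rw [this, hi]
          linarith
        · exact (key i hi).le
      · rw [mem_supp]
        intro h0
        exact hij ((hγ'K.2.2.2 i₀ j₀ h0).trans (hγK.2.2.2 i₀ j₀ h0).symm)
    have hmin := hγmin hmK
    simp only [Set.mem_ofPred_eq] at hmin
    linarith

/-- The copula array is the `I`-projection whenever a copula array has support inside `supp p`. -/
theorem isIProjection_copulaArray {r₁ r₂ : ℕ} (p : Matrix (Fin r₁) (Fin r₂) ℝ)
    (h : ∃ γ ∈ copulaArrays r₁ r₂, supp γ ⊆ supp p) : IsIProjection p (copulaArray p) := by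
  have h' := existsUnique_isIProjection p h
  rw [copulaArray, dif_pos h']
  exact h'.choose_spec.1

/-- `Δ°(S)`: arrays with support inside `S` and null margins. -/
def nullMarginArrays {r₁ r₂ : ℕ} (S : Finset (Fin r₁ × Fin r₂)) :
    Submodule ℝ (Matrix (Fin r₁) (Fin r₂) ℝ) where
  carrier := {a | (∀ i j, (i, j) ∉ S → a i j = 0) ∧ (∀ i, ∑ j, a i j = 0) ∧ ∀ j, ∑ i, a i j = 0}
  zero_mem' := by simp
  add_mem' := by
    rintro a b ⟨ha, ha₁, ha₂⟩ ⟨hb, hb₁, hb₂⟩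
    refine ⟨fun i j hij => ?_, fun i => ?_, fun j => ?_⟩
    · simp [ha i j hij, hb i j hij]
    · simp [Finset.sum_add_distrib, ha₁ i, hb₁ i]
    · simp [Finset.sum_add_distrib, ha₂ j, hb₂ j]
  smul_mem' := by
    rintro c a ⟨ha, ha₁, ha₂⟩
    refine ⟨fun i j hij => ?_, fun i => ?_, fun j => ?_⟩
    · simp [ha i j hij]
    · simp [← Finset.mul_sum, ha₁ i]
    · simp [← Finset.mul_sum, ha₂ j]

/-- The matrix `A_S` whose columns are the vectorised basis arrays. Here and below, vectorisation is
the column-major `Matrix.vec`, with positions labelled by `(i₂, i₁)`. -/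
def basisMatrix {r₁ r₂ : ℕ} {S : Finset (Fin r₁ × Fin r₂)} {d : ℕ}
    (b : Module.Basis (Fin d) ℝ (nullMarginArrays S)) : Matrix (Fin r₂ × Fin r₁) (Fin d) ℝ :=
  Matrix.of fun k l => vec (b l : Matrix (Fin r₁) (Fin r₂) ℝ) k

/-- The selection matrix `R_S`: the rows of the identity matrix at positions in `S`. -/
def selection {r₁ r₂ : ℕ} (S : Finset (Fin r₁ × Fin r₂)) :
    Matrix {k : Fin r₂ × Fin r₁ // (k.2, k.1) ∈ S} (Fin r₂ × Fin r₁) ℝ :=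
  (1 : Matrix (Fin r₂ × Fin r₁) (Fin r₂ × Fin r₁) ℝ).submatrix Subtype.val id

/-- The matrix `Ã_S = R_S A_S`. -/
def reducedBasisMatrix {r₁ r₂ : ℕ} {S : Finset (Fin r₁ × Fin r₂)} {d : ℕ}
    (b : Module.Basis (Fin d) ℝ (nullMarginArrays S)) :
    Matrix {k : Fin r₂ × Fin r₁ // (k.2, k.1) ∈ S} (Fin d) ℝ :=
  selection S * basisMatrix b

/-- The matrix `Ãᵀ diag⁻¹(R_S v) Ã`, for a vectorised array `v`. -/
def weightedGram {r₁ r₂ : ℕ} {S : Finset (Fin r₁ × Fin r₂)} {d : ℕ}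
    (b : Module.Basis (Fin d) ℝ (nullMarginArrays S)) (v : Fin r₂ × Fin r₁ → ℝ) :
    Matrix (Fin d) (Fin d) ℝ :=
  (reducedBasisMatrix b)ᵀ * (diagonal (selection S *ᵥ v))⁻¹ * reducedBasisMatrix b

/-- The Jacobian matrix at `p` of the map sending a vectorised probability array with support `S`
to its vectorised copula array:
`A [Ãᵀ diag⁻¹(R γ_p) Ã]⁻¹ Ãᵀ diag⁻¹(R p) R`. -/
def copulaJacobian {r₁ r₂ : ℕ} {S : Finset (Fin r₁ × Fin r₂)} {d : ℕ}
    (b : Module.Basis (Fin d) ℝ (nullMarginArrays S)) (p : Matrix (Fin r₁) (Fin r₂) ℝ) :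
    Matrix (Fin r₂ × Fin r₁) (Fin r₂ × Fin r₁) ℝ :=
  basisMatrix b * (weightedGram b (vec (copulaArray p)))⁻¹ * (reducedBasisMatrix b)ᵀ *
    (diagonal (selection S *ᵥ vec p))⁻¹ * selection S

/-- The matrix `Σ_γ = A [Ãᵀ diag⁻¹(R γ_p) Ã]⁻¹ [Ãᵀ diag⁻¹(R p) Ã] [Ãᵀ diag⁻¹(R γ_p) Ã]⁻¹ Aᵀ`. -/
def copulaCovariance {r₁ r₂ : ℕ} {S : Finset (Fin r₁ × Fin r₂)} {d : ℕ}
    (b : Module.Basis (Fin d) ℝ (nullMarginArrays S)) (p : Matrix (Fin r₁) (Fin r₂) ℝ) :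
    Matrix (Fin r₂ × Fin r₁) (Fin r₂ × Fin r₁) ℝ :=
  basisMatrix b * (weightedGram b (vec (copulaArray p)))⁻¹ * weightedGram b (vec p) *
    (weightedGram b (vec (copulaArray p)))⁻¹ * (basisMatrix b)ᵀ

/-- The probability array of a distribution `P` on the grid with coordinates `x₁` and `x₂`. -/
def probArray {r₁ r₂ : ℕ} (x₁ : Fin r₁ → ℝ) (x₂ : Fin r₂ → ℝ) (P : Measure (ℝ × ℝ)) :
    Matrix (Fin r₁) (Fin r₂) ℝ :=
  Matrix.of fun i j => P.real {(x₁ i, x₂ j)}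

open Classical in
/-- The empirical probability array of the first `n` observations. -/
def empiricalArray {Ω : Type*} {r₁ r₂ : ℕ} (x₁ : Fin r₁ → ℝ) (x₂ : Fin r₂ → ℝ)
    (X : ℕ → Ω → ℝ × ℝ) (n : ℕ) (ω : Ω) : Matrix (Fin r₁) (Fin r₂) ℝ :=
  Matrix.of fun i j =>
    (1 / (n : ℝ)) * ∑ k ∈ Finset.range n, if X k ω = (x₁ i, x₂ j) then (1 : ℝ) else 0

/-- The uniform probability array on `S`. -/
def uniformArray {r₁ r₂ : ℕ} (S : Finset (Fin r₁ × Fin r₂)) : Matrix (Fin r₁) (Fin r₂) ℝ :=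
  Matrix.of fun i j => if (i, j) ∈ S then 1 / (S.card : ℝ) else 0

/-- The smoothed empirical probability array `p̂ₙ`, for a known support `S`. -/
def smoothedArray {Ω : Type*} {r₁ r₂ : ℕ} (x₁ : Fin r₁ → ℝ) (x₂ : Fin r₂ → ℝ)
    (S : Finset (Fin r₁ × Fin r₂)) (X : ℕ → Ω → ℝ × ℝ) (n : ℕ) (ω : Ω) :
    Matrix (Fin r₁) (Fin r₂) ℝ :=
  ((n : ℝ) / (n + 1)) • empiricalArray x₁ x₂ X n ω + (1 / ((n : ℝ) + 1)) • uniformArray S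

/-- Vectorisation as a vector of Euclidean space. -/
def evec {r₁ r₂ : ℕ} (a : Matrix (Fin r₁) (Fin r₂) ℝ) : EuclideanSpace ℝ (Fin r₂ × Fin r₁) :=
  WithLp.toLp 2 (vec a)

/-- Yule's coefficient of a copula array; `(i : ℝ) + 1` is the rank of the index `i : Fin r`. -/
def yule {r₁ r₂ : ℕ} (γ : Matrix (Fin r₁) (Fin r₂) ℝ) : ℝ :=
  12 / √(((r₁ : ℝ) + 1) * (r₁ - 1) * (r₂ + 1) * (r₂ - 1)) *
      ∑ i : Fin r₁, ∑ j : Fin r₂, ((i : ℝ) + 1) * ((j : ℝ) + 1) * γ i j -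
    3 * (√(((r₁ : ℝ) + 1) * (r₂ + 1)) / √(((r₁ : ℝ) - 1) * (r₂ - 1)))

/-- The constant `κ`. -/
def kappa (r₁ r₂ : ℕ) : ℝ :=
  12 / √(((r₁ : ℝ) - 1) * (r₁ + 1) * (r₂ - 1) * (r₂ + 1))

/-- The Kronecker product of `(1, …, r₂)` and `(1, …, r₁)`. -/
def rankKron (r₁ r₂ : ℕ) : Fin r₂ × Fin r₁ → ℝ :=
  fun k => ((k.1 : ℝ) + 1) * ((k.2 : ℝ) + 1)

end

end DiscreteCopula

open DiscreteCopula

/-! The problem reduces to smooth calculus on the finite-dimensional space Δ°(S). Because x log x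
has slope −∞ at 0 and some copula array has support S, the I-projection is positive on all of S
(`IsIProjection.supp_eq`). Perturbations along ±a with a ∈ Δ°(S) are therefore admissible, and
stationarity reads ∑_S a log(γ/p) = 0 (`IsIProjection.sum_mul_log_eq_zero`). By convexity this
condition is also sufficient (`copulaArray_eq_of_sum_mul_log`).

For v near p with the same support, write the copula array of v as γ_p + ∑ t_l b_l. The condition
becomes Ãᵀ log(Rγ_p + Ãt) = Ãᵀ log(Rv). Its t-derivative at 0 is G(γ_p), which is positive definite,
so the inverse function theorem yields t(v), differentiable at p with derivative G(γ_p)⁻¹ Ãᵀ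
diag(Rp)⁻¹ R (`exists_hasFDerivAt_copulaArray_eq`). Applying A gives J, and since Υ is affine in γ,
the derivative of Υ within the arrays supported in S is κ kᵀJ (`hasFDerivWithinAt_yuleMap`).

The smoothed array is almost surely supported in S. Continuity within that set gives (a), and
`delta_method` gives (b). For (c), `tendstoInDistribution_of_inner` reduces the multinomial limit to
the real central limit theorem, and smoothing disappears by Slutsky. Finally J p = 0 removes the
term −p pᵀ from the covariance, leaving J diag(p) Jᵀ = Σ_γ. -/

namespace DiscreteCopula

/-! ### Variational characterisation of the I-projection. -/

section Deterministic

variable {r₁ r₂ : ℕ}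

theorem mem_copulaArrays_of_nonneg (hr₁ : 0 < r₁) (hr₂ : 0 < r₂)
    {γ : Matrix (Fin r₁) (Fin r₂) ℝ} (h0 : ∀ i j, 0 ≤ γ i j)
    (h₁ : ∀ i, ∑ j, γ i j = 1 / (r₁ : ℝ)) (h₂ : ∀ j, ∑ i, γ i j = 1 / (r₂ : ℝ)) :
    γ ∈ copulaArrays r₁ r₂ := by
  have h₁' : (0 : ℝ) < r₁ := by exact_mod_cast hr₁
  have h₂' : (0 : ℝ) < r₂ := by exact_mod_cast hr₂
  refine ⟨⟨fun i j => ⟨h0 i j, ?_⟩, ?_, fun i => ?_, fun j => ?_⟩, h₁, h₂⟩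
  · calc γ i j ≤ ∑ j, γ i j := Finset.single_le_sum (fun j _ => h0 i j) (Finset.mem_univ j)
      _ = 1 / (r₁ : ℝ) := h₁ i
      _ ≤ 1 := by
        rw [div_le_one h₁']
        exact_mod_cast hr₁
  · simp [h₁, h₁'.ne']
  · rw [h₁]; positivity
  · rw [h₂]; positivity

theorem eq_zero_of_notMem_supp {a : Matrix (Fin r₁) (Fin r₂) ℝ} {i : Fin r₁ × Fin r₂}
    (h : i ∉ supp a) : a i.1 i.2 = 0 := by
  simpa [mem_supp] using h

theorem iDiv_of_supp_subset {q p : Matrix (Fin r₁) (Fin r₂) ℝ} (h : supp q ⊆ supp p) :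
    iDiv q p =
      ((∑ i ∈ supp p, q i.1 i.2 * Real.log (q i.1 i.2 / p i.1 i.2) : ℝ) : EReal) := by
  rw [iDiv, if_pos h]

theorem IsIProjection.supp_subset {p γ : Matrix (Fin r₁) (Fin r₂) ℝ} (hγ : IsIProjection p γ)
    (h : ∃ γ ∈ copulaArrays r₁ r₂, supp γ ⊆ supp p) : supp γ ⊆ supp p := by
  obtain ⟨γ₀, h₀, hs⟩ := h
  by_contra hn
  have := hγ.2 γ₀ h₀
  rw [iDiv, if_neg hn, iDiv_of_supp_subset hs] at this
  exact absurd this (by simp)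

theorem IsIProjection.sum_le {p γ γ' : Matrix (Fin r₁) (Fin r₂) ℝ} (hγ : IsIProjection p γ)
    (hγ' : γ' ∈ copulaArrays r₁ r₂) (hs : supp γ' ⊆ supp p) :
    ∑ i ∈ supp p, γ i.1 i.2 * Real.log (γ i.1 i.2 / p i.1 i.2) ≤
      ∑ i ∈ supp p, γ' i.1 i.2 * Real.log (γ' i.1 i.2 / p i.1 i.2) := by
  have := hγ.2 γ' hγ'
  rw [iDiv_of_supp_subset (hγ.supp_subset ⟨γ', hγ', hs⟩), iDiv_of_supp_subset hs] at this
  exact_mod_cast this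

theorem mul_log_div_add_le {c x y s : ℝ} (hc : c ≠ 0) (hx : 0 ≤ x) (hy : 0 ≤ y)
    (hs0 : 0 ≤ s) (hs1 : s ≤ 1) :
    ((1 - s) * x + s * y) * Real.log (((1 - s) * x + s * y) / c) ≤
      (1 - s) * (x * Real.log (x / c)) + s * (y * Real.log (y / c)) := by
  have e : ∀ z : ℝ, z * Real.log (z / c) = z * Real.log z - z * Real.log c := by
    intro z
    rcases eq_or_ne z 0 with rfl | hz
    · simp
    · rw [Real.log_div hz hc]; ring
  have := Real.convexOn_mul_log.2 (Set.mem_Ici.2 hx) (Set.mem_Ici.2 hy)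
    (sub_nonneg.2 hs1) hs0 (by ring)
  simp only [smul_eq_mul] at this
  rw [e, e, e]
  linarith

/-- An `I`-projection has full support as soon as some copula array does. -/
theorem IsIProjection.supp_eq (hr₁ : 0 < r₁) (hr₂ : 0 < r₂)
    {p γ : Matrix (Fin r₁) (Fin r₂) ℝ} (hγ : IsIProjection p γ)
    (h : (copulaArraysOn (supp p)).Nonempty) : supp γ = supp p := by
  obtain ⟨γ₀, h₀, hs⟩ := h
  have hsub := hγ.supp_subset ⟨γ₀, h₀, hs.le⟩
  refine hsub.antisymm fun k hk => ?_
  by_contra hkγ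
  have hk0 : γ k.1 k.2 = 0 := eq_zero_of_notMem_supp hkγ
  have hγ₀k : 0 < γ₀ k.1 k.2 :=
    lt_of_le_of_ne (h₀.1.1 _ _).1 (Ne.symm (mem_supp.1 (hs ▸ hk)))
  set φ : Fin r₁ × Fin r₂ → ℝ → ℝ := fun i x => x * Real.log (x / p i.1 i.2) with hφ
  have hp : ∀ i ∈ supp p, p i.1 i.2 ≠ 0 := fun i hi => mem_supp.1 hi
  -- Move from γ towards γ₀ by a fraction s. Convexity bounds the increase by a multiple of s,
  -- except that the vacant cell k adds s γ₀(k) log s. Minimality, divided by s, then forces a bound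
  -- that fails as s → 0⁺, where log s → −∞.
  have key : ∀ s : ℝ, 0 < s → s ≤ 1 →
      0 ≤ (∑ i ∈ supp p, φ i (γ₀ i.1 i.2) - ∑ i ∈ supp p, φ i (γ i.1 i.2)) +
        γ₀ k.1 k.2 * Real.log s := by
    intro s hs0 hs1
    set γs : Matrix (Fin r₁) (Fin r₂) ℝ := Matrix.of fun i j => (1 - s) * γ i j + s * γ₀ i j
      with hγs
    have hmem : γs ∈ copulaArrays r₁ r₂ := by
      refine mem_copulaArrays_of_nonneg hr₁ hr₂ (fun i j => ?_) (fun i => ?_) (fun j => ?_)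
      · have h1 := (hγ.1.1.1 i j).1
        have h2 := (h₀.1.1 i j).1
        have h3 : 0 ≤ 1 - s := by linarith
        simp only [hγs, Matrix.of_apply]
        positivity
      · simp only [hγs, Matrix.of_apply, Finset.sum_add_distrib, ← Finset.mul_sum, hγ.1.2.1,
          h₀.2.1]
        ring
      · simp only [hγs, Matrix.of_apply, Finset.sum_add_distrib, ← Finset.mul_sum, hγ.1.2.2,
          h₀.2.2]
        ring
    have hsupp : supp γs ⊆ supp p := by
      intro i hi
      by_contra hn
      have h1 := eq_zero_of_notMem_supp (fun h => hn (hsub h))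
      have h2 := eq_zero_of_notMem_supp (a := γ₀) (i := i) (by rwa [hs])
      exact mem_supp.1 hi (by simp [hγs, h1, h2])
    have hle := hγ.sum_le hmem hsupp
    have hterm : ∑ i ∈ supp p, φ i (γs i.1 i.2) ≤
        ∑ i ∈ supp p, ((1 - s) * φ i (γ i.1 i.2) + s * φ i (γ₀ i.1 i.2) +
          if i = k then s * (γ₀ k.1 k.2 * Real.log s) else 0) := by
      refine Finset.sum_le_sum fun i hi => ?_
      split_ifs with hik
      · subst hik
        simp only [hγs, hφ, Matrix.of_apply, hk0]
        have e : s * γ₀ i.1 i.2 / p i.1 i.2 = s * (γ₀ i.1 i.2 / p i.1 i.2) := by ring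
        simp only [mul_zero, zero_add, zero_mul, e]
        rw [Real.log_mul hs0.ne' (div_ne_zero hγ₀k.ne' (hp i hi))]
        apply le_of_eq
        ring
      · rw [add_zero]
        exact mul_log_div_add_le (hp i hi) (hγ.1.1.1 _ _).1 (h₀.1.1 _ _).1 hs0.le hs1
    rw [Finset.sum_add_distrib, Finset.sum_add_distrib, Finset.sum_ite_eq' , if_pos hk,
      ← Finset.mul_sum, ← Finset.mul_sum] at hterm
    have : 0 ≤ s * ((∑ i ∈ supp p, φ i (γ₀ i.1 i.2) - ∑ i ∈ supp p, φ i (γ i.1 i.2)) +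
        γ₀ k.1 k.2 * Real.log s) := by
      have := hle.trans hterm
      simp only [hφ] at this ⊢
      linarith
    exact nonneg_of_mul_nonneg_right this hs0
  have hlim : Tendsto (fun s : ℝ => (∑ i ∈ supp p, φ i (γ₀ i.1 i.2) -
      ∑ i ∈ supp p, φ i (γ i.1 i.2)) + γ₀ k.1 k.2 * Real.log s) (𝓝[>] 0) atBot :=
    tendsto_atBot_add_const_left _ _ (Real.tendsto_log_nhdsGT_zero.const_mul_atBot hγ₀k)
  obtain ⟨s, hs1, hs2, hs3⟩ := ((hlim.eventually_lt_atBot 0).and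
    ((Ioc_mem_nhdsGT (zero_lt_one' ℝ)))).exists
  exact absurd (key s hs2 hs3) (not_le.2 hs1)

/-- First-order condition for the `I`-projection. -/
theorem IsIProjection.sum_mul_log_eq_zero (hr₁ : 0 < r₁) (hr₂ : 0 < r₂)
    {p γ : Matrix (Fin r₁) (Fin r₂) ℝ} (hγ : IsIProjection p γ) (hs : supp γ = supp p)
    {a : Matrix (Fin r₁) (Fin r₂) ℝ} (ha : a ∈ nullMarginArrays (supp p)) :
    ∑ i ∈ supp p, a i.1 i.2 * Real.log (γ i.1 i.2 / p i.1 i.2) = 0 := by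
  have hγpos : ∀ i : Fin r₁ × Fin r₂, i ∈ supp p → 0 < γ i.1 i.2 := fun i hi =>
    lt_of_le_of_ne (hγ.1.1.1 i.1 i.2).1 (Ne.symm (mem_supp.1 (hs.symm ▸ hi)))
  have hp : ∀ i ∈ supp p, p i.1 i.2 ≠ 0 := fun i hi => mem_supp.1 hi
  have hasum : ∑ i ∈ supp p, a i.1 i.2 = 0 := by
    have : ∑ i ∈ supp p, a i.1 i.2 = ∑ i : Fin r₁ × Fin r₂, a i.1 i.2 :=
      Finset.sum_subset (Finset.subset_univ _) fun i _ hi => ha.1 i.1 i.2 hi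
    rw [this, Fintype.sum_prod_type]
    simp [ha.2.1]
  set F : ℝ → ℝ := fun t => ∑ i ∈ supp p, (γ i.1 i.2 + t * a i.1 i.2) *
    Real.log ((γ i.1 i.2 + t * a i.1 i.2) / p i.1 i.2) with hF
  -- Since γ is positive on the support, γ + t a stays a copula array for small t of either sign, so
  -- 0 is an interior minimum of F.
  have hmin : IsLocalMin F 0 := by
    have hpos : ∀ᶠ t : ℝ in 𝓝 0, ∀ i : Fin r₁ × Fin r₂, i ∈ supp p → 0 < γ i.1 i.2 + t * a i.1 i.2 := by
      rw [Filter.eventually_all_finset]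
      intro i hi
      have : Tendsto (fun t : ℝ => γ i.1 i.2 + t * a i.1 i.2) (𝓝 0)
          (𝓝 (γ i.1 i.2 + 0 * a i.1 i.2)) :=
        (Continuous.tendsto (by fun_prop) 0)
      exact this.eventually_const_lt (by simpa using hγpos i hi)
    filter_upwards [hpos] with t ht
    have hoff : ∀ i, i ∉ supp p → γ i.1 i.2 + t * a i.1 i.2 = 0 := fun i hi => by
      rw [eq_zero_of_notMem_supp (a := γ) (i := i) (by rwa [hs]), ha.1 i.1 i.2 hi]; ring
    have hmem : Matrix.of (fun i j => γ i j + t * a i j) ∈ copulaArrays r₁ r₂ := by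
      refine mem_copulaArrays_of_nonneg hr₁ hr₂ (fun i j => ?_) (fun i => ?_) (fun j => ?_)
      · by_cases h : (i, j) ∈ supp p
        · exact (ht _ h).le
        · exact (hoff _ h).ge
      · simp [Finset.sum_add_distrib, ← Finset.mul_sum, hγ.1.2.1, ha.2.1]
      · simp [Finset.sum_add_distrib, ← Finset.mul_sum, hγ.1.2.2, ha.2.2]
    have hsub : supp (Matrix.of (fun i j => γ i j + t * a i j)) ⊆ supp p := by
      intro i hi
      by_contra hn
      exact mem_supp.1 hi (hoff i hn)
    simpa [hF] using hγ.sum_le hmem hsub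
  -- The additional summand a comes from differentiating the logarithm; its total is zero because a
  -- has null margins.
  have hder : HasDerivAt F (∑ i ∈ supp p,
      (a i.1 i.2 * Real.log (γ i.1 i.2 / p i.1 i.2) + a i.1 i.2)) 0 := by
    refine HasDerivAt.fun_sum fun i hi => ?_
    have hlin : HasDerivAt (fun t : ℝ => γ i.1 i.2 + t * a i.1 i.2) (a i.1 i.2) 0 := by
      simpa using ((hasDerivAt_id (0 : ℝ)).mul_const (a i.1 i.2)).const_add (γ i.1 i.2)
    have hg := (hγpos i hi).ne'
    have := hlin.mul ((hlin.div_const (p i.1 i.2)).log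
      (by simpa using ⟨hg, hp i hi⟩))
    refine this.congr_deriv ?_
    have := hp i hi
    simp only [zero_mul, add_zero]
    field_simp
  have := hmin.hasDerivAt_eq_zero hder
  rwa [Finset.sum_add_distrib, hasum, add_zero] at this

/-- The first-order condition characterises the `I`-projection. -/
theorem copulaArray_eq_of_sum_mul_log {v γ : Matrix (Fin r₁) (Fin r₂) ℝ}
    (hγ : γ ∈ copulaArrays r₁ r₂) (hs : supp γ = supp v) (hv : ∀ i ∈ supp v, 0 < v i.1 i.2)
    (hfoc : ∀ a ∈ nullMarginArrays (supp v),
      ∑ i ∈ supp v, a i.1 i.2 * Real.log (γ i.1 i.2 / v i.1 i.2) = 0) :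
    copulaArray v = γ := by
  have hex := existsUnique_isIProjection v ⟨γ, hγ, hs.le⟩
  refine hex.unique (isIProjection_copulaArray v ⟨γ, hγ, hs.le⟩) ⟨hγ, fun γ' hγ' => ?_⟩
  by_cases hs' : supp γ' ⊆ supp v
  swap
  · rw [iDiv, iDiv, if_neg hs']; exact le_top
  rw [iDiv_of_supp_subset hs.le, iDiv_of_supp_subset hs']
  norm_cast
  have hγpos : ∀ i : Fin r₁ × Fin r₂, i ∈ supp v → 0 < γ i.1 i.2 := fun i hi =>
    lt_of_le_of_ne (hγ.1.1 i.1 i.2).1 (Ne.symm (mem_supp.1 (hs.symm ▸ hi)))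
  have hd : γ' - γ ∈ nullMarginArrays (supp v) := by
    refine ⟨fun i j hij => ?_, fun i => ?_, fun j => ?_⟩
    · have h1 : γ' i j = 0 := eq_zero_of_notMem_supp (i := (i, j)) fun h => hij (hs' h)
      have h2 : γ i j = 0 := eq_zero_of_notMem_supp (i := (i, j)) fun h => hij (hs ▸ h)
      simp [h1, h2]
    · simp [hγ.2.1, hγ'.2.1]
    · simp [hγ.2.2, hγ'.2.2]
  have hsum : ∑ i ∈ supp v, (γ' i.1 i.2 - γ i.1 i.2) = 0 := by
    have : ∑ i ∈ supp v, (γ' - γ) i.1 i.2 = ∑ i : Fin r₁ × Fin r₂, (γ' - γ) i.1 i.2 :=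
      Finset.sum_subset (Finset.subset_univ _) fun i _ hi => hd.1 i.1 i.2 hi
    rw [Fintype.sum_prod_type] at this
    simpa [hd.2.1] using this.trans (Finset.sum_eq_zero fun i _ => hd.2.1 i)
  have h0 := hfoc _ hd
  -- Tangent-line bound for the convex function x log(x/v) at γ, equivalent to γ' − γ ≤ γ'
  -- log(γ'/γ). After summation the first term vanishes by the margins and the second by the
  -- first-order condition.
  have hterm : ∀ i ∈ supp v, (γ' i.1 i.2 - γ i.1 i.2) +
      (γ' - γ) i.1 i.2 * Real.log (γ i.1 i.2 / v i.1 i.2) +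
      γ i.1 i.2 * Real.log (γ i.1 i.2 / v i.1 i.2) ≤
        γ' i.1 i.2 * Real.log (γ' i.1 i.2 / v i.1 i.2) := by
    intro i hi
    have hg := hγpos i hi
    have hvi := hv i hi
    rcases (hγ'.1.1 i.1 i.2).1.eq_or_lt with h | h
    · simp only [Matrix.sub_apply, ← h]
      simp only [zero_mul]
      linarith
    · have := Real.one_sub_inv_le_log_of_pos (div_pos h hg)
      have h2 : γ' i.1 i.2 * (1 - (γ' i.1 i.2 / γ i.1 i.2)⁻¹) = γ' i.1 i.2 - γ i.1 i.2 := by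
        field_simp
      have h3 := mul_le_mul_of_nonneg_left this h.le
      rw [h2, Real.log_div h.ne' hg.ne'] at h3
      simp only [Matrix.sub_apply]
      rw [Real.log_div h.ne' hvi.ne', Real.log_div hg.ne' hvi.ne']
      linarith
  have := Finset.sum_le_sum hterm
  rw [Finset.sum_add_distrib, Finset.sum_add_distrib, hsum, h0] at this
  linarith

end Deterministic

/-! ### The log-linear system and the inverse function theorem. -/

section LogLinear

variable {l m n : Type*} [Fintype l] [Fintype m] [Fintype n] [DecidableEq m]

/-- The second matrix is kept free to serve both sides of the system: C = B for the unknown t, and C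
= 1 for the data. Strictness is what the inverse function theorem requires. -/
theorem hasStrictFDerivAt_transpose_mulVec_log (B : Matrix m n ℝ) (C : Matrix m l ℝ) {g : m → ℝ}
    (hg : ∀ k, g k ≠ 0) :
    HasStrictFDerivAt (fun t : l → ℝ => Bᵀ *ᵥ fun k => Real.log (g k + (C *ᵥ t) k))
      (LinearMap.toContinuousLinearMap (Bᵀ * diagonal (fun k => (g k)⁻¹) * C).mulVecLin) 0 := by
  have h1 : ∀ k, HasStrictFDerivAt (fun t : l → ℝ => Real.log (g k + (C *ᵥ t) k))
      ((g k)⁻¹ • (ContinuousLinearMap.proj (R := ℝ) (φ := fun _ : m => ℝ) k ∘SL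
        LinearMap.toContinuousLinearMap C.mulVecLin)) 0 := by
    intro k
    have h2 : HasStrictFDerivAt (fun t : l → ℝ => (C *ᵥ t) k)
        (ContinuousLinearMap.proj (R := ℝ) (φ := fun _ : m => ℝ) k ∘SL
        LinearMap.toContinuousLinearMap C.mulVecLin) 0 :=
      (ContinuousLinearMap.proj (R := ℝ) (φ := fun _ : m => ℝ) k ∘SL
        LinearMap.toContinuousLinearMap C.mulVecLin).hasStrictFDerivAt
    have h3 := (h2.const_add (g k)).log (by simpa using hg k)
    simpa using h3
  have h4 := ((LinearMap.toContinuousLinearMap Bᵀ.mulVecLin).hasStrictFDerivAt).comp (0 : l → ℝ)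
    (hasStrictFDerivAt_pi.2 h1)
  refine h4.congr_fderiv ?_
  ext1 t
  simp only [ContinuousLinearMap.comp_apply, LinearMap.coe_toContinuousLinearMap',
    Matrix.mulVecLin_apply, ← Matrix.mulVec_mulVec]
  congr 1
  ext k
  simp [Matrix.mulVec_diagonal]

/-- Local solution of the log-linear system `Bᵀ log (g + B t) = Bᵀ log v` in the unknown `t`. -/
theorem exists_hasFDerivAt_transpose_mulVec_log_eq [DecidableEq n] (B : Matrix m n ℝ) {g q : m → ℝ}
    (hg : ∀ k, g k ≠ 0) (hq : ∀ k, q k ≠ 0)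
    (hG : IsUnit (Bᵀ * diagonal (fun k => (g k)⁻¹) * B))
    (h0 : (Bᵀ *ᵥ fun k => Real.log (g k)) = Bᵀ *ᵥ fun k => Real.log (q k)) :
    ∃ t : (m → ℝ) → n → ℝ, t q = 0 ∧
      HasFDerivAt t (LinearMap.toContinuousLinearMap
        ((Bᵀ * diagonal (fun k => (g k)⁻¹) * B)⁻¹ * Bᵀ *
          diagonal (fun k => (q k)⁻¹)).mulVecLin) q ∧
      ∀ᶠ v in 𝓝 q, (Bᵀ *ᵥ fun k => Real.log (g k + (B *ᵥ t v) k)) =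
        Bᵀ *ᵥ fun k => Real.log (v k) := by
  set G := Bᵀ * diagonal (fun k => (g k)⁻¹) * B with hGdef
  have hdet : IsUnit G.det := (Matrix.isUnit_iff_isUnit_det G).1 hG
  let e : (n → ℝ) ≃L[ℝ] (n → ℝ) := (LinearEquiv.ofLinearMap G.mulVecLin G⁻¹.mulVecLin
    (by rw [← Matrix.mulVecLin_mul, Matrix.mul_nonsing_inv G hdet, Matrix.mulVecLin_one])
    (by rw [← Matrix.mulVecLin_mul, Matrix.nonsing_inv_mul G hdet, Matrix.mulVecLin_one])
    ).toContinuousLinearEquiv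
  have he : ∀ t, e t = G *ᵥ t := fun t => rfl
  have he' : ∀ t, e.symm t = G⁻¹ *ᵥ t := fun t => rfl
  set H : (n → ℝ) → n → ℝ := fun t => Bᵀ *ᵥ fun k => Real.log (g k + (B *ᵥ t) k) with hH
  have hstrict : HasStrictFDerivAt H (e : (n → ℝ) →L[ℝ] (n → ℝ)) 0 := by
    refine (hasStrictFDerivAt_transpose_mulVec_log B B hg).congr_fderiv ?_
    ext1 t
    exact (he t).symm
  set K : (m → ℝ) → n → ℝ := fun v => Bᵀ *ᵥ fun k => Real.log (v k) with hK
  have hKd : HasFDerivAt K (LinearMap.toContinuousLinearMap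
      (Bᵀ * diagonal (fun k => (q k)⁻¹)).mulVecLin) q := by
    -- K at v is the map with C = 1 and base point q, evaluated at v − q.
    have h1 := (hasStrictFDerivAt_transpose_mulVec_log B (1 : Matrix m m ℝ) hq).hasFDerivAt
    have h2 : HasFDerivAt (fun v : m → ℝ => v - q) (ContinuousLinearMap.id ℝ (m → ℝ)) q :=
      (hasFDerivAt_id q).sub_const q
    simp only [Matrix.mul_one, Matrix.one_mulVec] at h1
    have h3 := HasFDerivAt.comp (f := fun v : m → ℝ => v - q) q (by rwa [sub_self]) h2
    simpa only [Function.comp_def, add_sub_cancel, Pi.sub_apply, ContinuousLinearMap.comp_id]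
      using h3
  have hKq : K q = H 0 := by simp [hK, hH, h0]
  -- The solution is H⁻¹ ∘ K locally. The hypothesis `h0` says K q = H 0, so K v lies in the domain
  -- of the local inverse for v near q.
  refine ⟨fun v => hstrict.localInverse H e 0 (K v), ?_, ?_, ?_⟩
  · change hstrict.localInverse H e 0 (K q) = 0
    rw [hKq]
    exact hstrict.localInverse_apply_image
  · have h1 := hstrict.to_localInverse.hasFDerivAt
    rw [← hKq] at h1
    have h2 := h1.comp q hKd
    refine h2.congr_fderiv ?_
    ext1 t
    rw [Matrix.mul_assoc, ContinuousLinearMap.comp_apply]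
    simp only [LinearMap.coe_toContinuousLinearMap', Matrix.mulVecLin_apply,
      ← Matrix.mulVec_mulVec]
    exact he' _
  · have h1 := hstrict.eventually_right_inverse
    rw [← hKq] at h1
    exact hKd.continuousAt.eventually h1

end LogLinear

/-! ### The matrices Ã and G(v) in coordinates. -/

section Differentiability

variable {r₁ r₂ : ℕ} {S : Finset (Fin r₁ × Fin r₂)} {d : ℕ}
  (b : Module.Basis (Fin d) ℝ (nullMarginArrays S))

theorem selection_mulVec (v : Fin r₂ × Fin r₁ → ℝ) : selection S *ᵥ v = fun k => v k.1 := by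
  ext k
  simp [selection, Matrix.mulVec, dotProduct, Matrix.one_apply]

theorem inv_diagonal_selection_mulVec {v : Fin r₂ × Fin r₁ → ℝ}
    (hv : ∀ k : {k : Fin r₂ × Fin r₁ // (k.2, k.1) ∈ S}, v k.1 ≠ 0) :
    (diagonal (selection S *ᵥ v))⁻¹ = diagonal fun k => (v k.1)⁻¹ := by
  refine Matrix.inv_eq_right_inv ?_
  rw [selection_mulVec, Matrix.diagonal_mul_diagonal, ← Matrix.diagonal_one]
  congr 1
  ext k
  exact mul_inv_cancel₀ (hv k)

theorem reducedBasisMatrix_apply (k : {k : Fin r₂ × Fin r₁ // (k.2, k.1) ∈ S}) (l : Fin d) :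
    reducedBasisMatrix b k l = (b l : Matrix (Fin r₁) (Fin r₂) ℝ) k.1.2 k.1.1 := by
  simp [reducedBasisMatrix, selection, Matrix.mul_apply, Matrix.one_apply, basisMatrix,
    Matrix.vec]

theorem basisMatrix_mulVec (t : Fin d → ℝ) :
    basisMatrix b *ᵥ t =
      vec ((∑ l, t l • b l : nullMarginArrays S) : Matrix (Fin r₁) (Fin r₂) ℝ) := by
  ext k
  simp [basisMatrix, Matrix.mulVec, dotProduct, Matrix.vec, Matrix.sum_apply, mul_comm]

theorem reducedBasisMatrix_mulVec (t : Fin d → ℝ) :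
    reducedBasisMatrix b *ᵥ t = fun k => (basisMatrix b *ᵥ t) k.1 := by
  rw [reducedBasisMatrix, ← Matrix.mulVec_mulVec, selection_mulVec]

/-- Restriction to S loses nothing: arrays of Δ°(S) already vanish off S, so linear independence of
the basis survives. -/
theorem reducedBasisMatrix_mulVec_injective :
    Function.Injective (reducedBasisMatrix b).mulVec := by
  rw [← Matrix.coe_mulVecLin, ← LinearMap.ker_eq_bot, LinearMap.ker_eq_bot']
  intro t ht
  have h0 : (∑ l, t l • b l : nullMarginArrays S) = 0 := by
    ext i j
    by_cases hij : (i, j) ∈ S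
    · have := congrFun ht ⟨(j, i), hij⟩
      rw [Matrix.mulVecLin_apply, reducedBasisMatrix_mulVec, basisMatrix_mulVec] at this
      simpa [Matrix.vec] using this
    · exact (∑ l, t l • b l : nullMarginArrays S).2.1 i j hij
  exact funext (Fintype.linearIndependent_iff.1 b.linearIndependent t h0)

theorem weightedGram_eq {v : Fin r₂ × Fin r₁ → ℝ}
    (hv : ∀ k : {k : Fin r₂ × Fin r₁ // (k.2, k.1) ∈ S}, v k.1 ≠ 0) :
    weightedGram b v = (reducedBasisMatrix b)ᵀ *
      (diagonal fun k : {k : Fin r₂ × Fin r₁ // (k.2, k.1) ∈ S} => (v k.1)⁻¹) *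
      reducedBasisMatrix b := by
  rw [weightedGram, inv_diagonal_selection_mulVec hv]

/-- A positive diagonal form pulled back along an injective map. This supplies the invertibility of
G(γ_p). -/
theorem weightedGram_posDef {v : Fin r₂ × Fin r₁ → ℝ}
    (hv : ∀ k : {k : Fin r₂ × Fin r₁ // (k.2, k.1) ∈ S}, 0 < v k.1) :
    (weightedGram b v).PosDef := by
  rw [weightedGram_eq b fun k => (hv k).ne', ← Matrix.conjTranspose_eq_transpose_of_trivial]
  refine Matrix.PosDef.conjTranspose_mul_mul_same ?_ (reducedBasisMatrix_mulVec_injective b)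
  exact Matrix.PosDef.diagonal fun k => inv_pos.2 (hv k)

theorem sum_selection (f : Fin r₁ × Fin r₂ → ℝ) :
    ∑ k : {k : Fin r₂ × Fin r₁ // (k.2, k.1) ∈ S}, f (k.1.2, k.1.1) = ∑ i ∈ S, f i := by
  rw [← Finset.sum_coe_sort S]
  exact Fintype.sum_equiv ((Equiv.prodComm _ _).subtypeEquiv fun k => Iff.rfl) _ _ fun k => rfl

/-- Passes from orthogonality to the basis arrays to orthogonality to all of Δ°(S), by linearity.
With the converse below, it translates the first-order condition to and from matrix form. -/
theorem forall_transpose_reducedBasisMatrix {f : Fin r₁ × Fin r₂ → ℝ}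
    (h : (reducedBasisMatrix b)ᵀ *ᵥ (fun k => f (k.1.2, k.1.1)) = 0)
    {a : Matrix (Fin r₁) (Fin r₂) ℝ} (ha : a ∈ nullMarginArrays S) :
    ∑ i ∈ S, a i.1 i.2 * f i = 0 := by
  have hl : ∀ l, ∑ i ∈ S, (b l : Matrix (Fin r₁) (Fin r₂) ℝ) i.1 i.2 * f i = 0 := by
    intro l
    rw [← sum_selection (fun i => (b l : Matrix (Fin r₁) (Fin r₂) ℝ) i.1 i.2 * f i)]
    simpa [Matrix.mulVec, dotProduct, reducedBasisMatrix_apply] using congrFun h l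
  let φ : nullMarginArrays S →ₗ[ℝ] ℝ :=
    { toFun := fun a => ∑ i ∈ S, (a : Matrix (Fin r₁) (Fin r₂) ℝ) i.1 i.2 * f i
      map_add' := fun a c => by simp [add_mul, Finset.sum_add_distrib]
      map_smul' := fun c a => by simp [Finset.mul_sum, mul_assoc] }
  have : φ = 0 := b.ext fun l => hl l
  exact LinearMap.congr_fun this ⟨a, ha⟩

theorem transpose_reducedBasisMatrix_mulVec_eq_zero {f : Fin r₁ × Fin r₂ → ℝ}
    (h : ∀ a ∈ nullMarginArrays S, ∑ i ∈ S, a i.1 i.2 * f i = 0) :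
    (reducedBasisMatrix b)ᵀ *ᵥ (fun k => f (k.1.2, k.1.1)) = 0 := by
  ext l
  have := h _ (b l).2
  rw [← sum_selection] at this
  simpa [Matrix.mulVec, dotProduct, reducedBasisMatrix_apply] using this

end Differentiability

/-! ### Yule's coefficient as an affine function. -/

section Yule

variable {r₁ r₂ : ℕ}

/-- The array whose column-major vectorisation is a given vector. -/
def unvec (v : Fin r₂ × Fin r₁ → ℝ) : Matrix (Fin r₁) (Fin r₂) ℝ :=
  Matrix.of fun i j => v (j, i)

theorem rankKron_dotProduct_vec (a : Matrix (Fin r₁) (Fin r₂) ℝ) :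
    rankKron r₁ r₂ ⬝ᵥ vec a = ∑ i : Fin r₁, ∑ j : Fin r₂, ((i : ℝ) + 1) * ((j : ℝ) + 1) * a i j := by
  rw [dotProduct, Fintype.sum_prod_type, Finset.sum_comm]
  refine Finset.sum_congr rfl fun i _ => Finset.sum_congr rfl fun j _ => ?_
  simp only [rankKron, Matrix.vec]
  ring

theorem yule_add (γ a : Matrix (Fin r₁) (Fin r₂) ℝ) :
    yule (γ + a) = yule γ + kappa r₁ r₂ * (rankKron r₁ r₂ ⬝ᵥ vec a) := by
  have : kappa r₁ r₂ = 12 / √(((r₁ : ℝ) + 1) * (r₁ - 1) * (r₂ + 1) * (r₂ - 1)) := by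
    rw [kappa]; congr 2; ring
  rw [rankKron_dotProduct_vec, this, yule, yule]
  simp only [Matrix.add_apply, mul_add, Finset.sum_add_distrib]
  ring

end Yule

/-! ### Differentiability of the copula map and of Yule's coefficient. -/

section CopulaMap

variable {r₁ r₂ : ℕ} {p : Matrix (Fin r₁) (Fin r₂) ℝ} {d : ℕ}

theorem supp_copulaArray (hr₁ : 0 < r₁) (hr₂ : 0 < r₂)
    (hΓ : (copulaArraysOn (supp p)).Nonempty) : supp (copulaArray p) = supp p :=
  (isIProjection_copulaArray p (hΓ.imp fun _ h => ⟨h.1, h.2.le⟩)).supp_eq hr₁ hr₂ hΓ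

theorem copulaArray_mem (hΓ : (copulaArraysOn (supp p)).Nonempty) :
    copulaArray p ∈ copulaArrays r₁ r₂ :=
  (isIProjection_copulaArray p (hΓ.imp fun _ h => ⟨h.1, h.2.le⟩)).1

theorem copulaArray_pos (hr₁ : 0 < r₁) (hr₂ : 0 < r₂)
    (hΓ : (copulaArraysOn (supp p)).Nonempty) {i : Fin r₁ × Fin r₂} (hi : i ∈ supp p) :
    0 < copulaArray p i.1 i.2 :=
  lt_of_le_of_ne ((copulaArray_mem hΓ).1.1 _ _).1
    (Ne.symm (mem_supp.1 ((supp_copulaArray hr₁ hr₂ hΓ).symm ▸ hi)))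

theorem supp_eq_of_pos_of_eq_zero {a : Matrix (Fin r₁) (Fin r₂) ℝ} {S : Finset (Fin r₁ × Fin r₂)}
    (h : ∀ i ∈ S, 0 < a i.1 i.2) (h' : ∀ i, i ∉ S → a i.1 i.2 = 0) : supp a = S := by
  ext i
  rw [mem_supp]
  exact ⟨fun hi => by_contra fun hn => hi (h' i hn), fun hi => (h i hi).ne'⟩

/-- The copula map near `p`, in the coordinates given by a basis of the null-margin arrays. -/
theorem exists_hasFDerivAt_copulaArray_eq (hr₁ : 0 < r₁) (hr₂ : 0 < r₂)
    (hp : ∀ i ∈ supp p, 0 < p i.1 i.2) (hΓ : (copulaArraysOn (supp p)).Nonempty)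
    (b : Module.Basis (Fin d) ℝ (nullMarginArrays (supp p))) :
    ∃ t : (Fin r₂ × Fin r₁ → ℝ) → Fin d → ℝ, t (vec p) = 0 ∧
      HasFDerivAt t (LinearMap.toContinuousLinearMap
        ((weightedGram b (vec (copulaArray p)))⁻¹ * (reducedBasisMatrix b)ᵀ *
          (diagonal (selection (supp p) *ᵥ vec p))⁻¹ * selection (supp p)).mulVecLin) (vec p) ∧
      ∀ᶠ v in 𝓝 (vec p), (∀ i, i ∉ supp p → v (i.2, i.1) = 0) →
        copulaArray (unvec v) = copulaArray p + (∑ l, t v l • b l : nullMarginArrays (supp p)) := by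
  have hproj := isIProjection_copulaArray p (hΓ.imp fun _ h => ⟨h.1, h.2.le⟩)
  have hgs := supp_copulaArray hr₁ hr₂ hΓ
  have hgmem := copulaArray_mem hΓ
  have hgpos : ∀ i : Fin r₁ × Fin r₂, i ∈ supp p → 0 < copulaArray p i.1 i.2 :=
    fun i hi => copulaArray_pos hr₁ hr₂ hΓ hi
  set g := copulaArray p with hg
  set B := reducedBasisMatrix b with hB
  have hgne : ∀ k : {k : Fin r₂ × Fin r₁ // (k.2, k.1) ∈ supp p}, 0 < vec g k.1 :=
    fun k => hgpos _ k.2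
  have hpne : ∀ k : {k : Fin r₂ × Fin r₁ // (k.2, k.1) ∈ supp p}, 0 < vec p k.1 :=
    fun k => hp _ k.2
  have hG := weightedGram_eq b fun k => (hgne k).ne'
  have hGu := (weightedGram_posDef b hgne).isUnit
  rw [hG] at hGu
  have hfoc : (Bᵀ *ᵥ fun k => Real.log (vec g k.1)) = Bᵀ *ᵥ fun k => Real.log (vec p k.1) := by
    rw [← sub_eq_zero, ← Matrix.mulVec_sub]
    refine transpose_reducedBasisMatrix_mulVec_eq_zero b
      (f := fun i => Real.log (g i.1 i.2) - Real.log (p i.1 i.2)) fun a ha => ?_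
    rw [← hproj.sum_mul_log_eq_zero hr₁ hr₂ hgs ha]
    refine Finset.sum_congr rfl fun i hi => ?_
    rw [Real.log_div (hgpos i hi).ne' (hp i hi).ne']
  obtain ⟨t, ht0, htd, hteq⟩ := exists_hasFDerivAt_transpose_mulVec_log_eq B
    (g := fun k => vec g k.1) (q := fun k => vec p k.1) (fun k => (hgne k).ne')
    (fun k => (hpne k).ne') hGu hfoc
  have hR : HasFDerivAt (fun v : Fin r₂ × Fin r₁ → ℝ => selection (supp p) *ᵥ v)
      (LinearMap.toContinuousLinearMap (selection (supp p)).mulVecLin) (vec p) :=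
    (LinearMap.toContinuousLinearMap (selection (supp p)).mulVecLin).hasFDerivAt
  have hRp : selection (supp p) *ᵥ vec p = fun k => vec p k.1 := selection_mulVec _
  have htR : HasFDerivAt (fun v => t (selection (supp p) *ᵥ v)) (LinearMap.toContinuousLinearMap
      ((weightedGram b (vec g))⁻¹ * Bᵀ *
        (diagonal (selection (supp p) *ᵥ vec p))⁻¹ * selection (supp p)).mulVecLin) (vec p) := by
    rw [hG, inv_diagonal_selection_mulVec fun k => (hpne k).ne']
    rw [← hRp] at htd
    refine (htd.comp (vec p) hR).congr_fderiv ?_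
    ext1 w
    simp only [ContinuousLinearMap.comp_apply, LinearMap.coe_toContinuousLinearMap',
      Matrix.mulVecLin_apply, ← Matrix.mulVec_mulVec]
    rfl
  refine ⟨fun v => t (selection (supp p) *ᵥ v), (congrArg t hRp).trans ht0, htR, ?_⟩
  have hev1 : ∀ᶠ v in 𝓝 (vec p), (Bᵀ *ᵥ fun k => Real.log (vec g k.1 +
      (B *ᵥ t (selection (supp p) *ᵥ v)) k)) = Bᵀ *ᵥ fun k => Real.log ((selection (supp p) *ᵥ v) k) := by
    rw [← hRp] at hteq
    exact hR.continuousAt.eventually hteq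
  have hev2 : ∀ᶠ v in 𝓝 (vec p), ∀ k : {k : Fin r₂ × Fin r₁ // (k.2, k.1) ∈ supp p},
      0 < v k.1 := by
    rw [Filter.eventually_all]
    exact fun k => (continuous_apply k.1).continuousAt.eventually_const_lt (hpne k)
  -- The solution t is continuous at p with value 0 there, so positivity of γ_p on S persists.
  have hev3 : ∀ᶠ v in 𝓝 (vec p), ∀ k : {k : Fin r₂ × Fin r₁ // (k.2, k.1) ∈ supp p},
      0 < vec g k.1 + (B *ᵥ t (selection (supp p) *ᵥ v)) k := by
    rw [Filter.eventually_all]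
    intro k
    have hc : ContinuousAt (fun v => vec g k.1 + (B *ᵥ t (selection (supp p) *ᵥ v)) k) (vec p) := by
      have h1 : Continuous fun w : Fin d → ℝ => vec g k.1 + (B *ᵥ w) k := by
        have : Continuous fun w : Fin d → ℝ => B *ᵥ w := continuous_const.matrix_mulVec continuous_id
        fun_prop
      exact h1.continuousAt.comp htR.continuousAt
    refine hc.eventually_const_lt ?_
    beta_reduce
    rw [hRp, ht0, Matrix.mulVec_zero]
    simpa using hgne k
  -- Adding an element of Δ°(S) preserves the margins, so γ_p + a is a copula array with the support
  -- of v. The log-linear system is its first-order condition, hence it is the copula array of v.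
  filter_upwards [hev1, hev2, hev3] with v h1 h2 h3 hoff
  set w := t (selection (supp p) *ᵥ v) with hw
  set a : nullMarginArrays (supp p) := ∑ l, w l • b l with ha
  have haB : ∀ k : {k : Fin r₂ × Fin r₁ // (k.2, k.1) ∈ supp p},
      (B *ᵥ w) k = (a : Matrix (Fin r₁) (Fin r₂) ℝ) k.1.2 k.1.1 := by
    intro k
    rw [hB, reducedBasisMatrix_mulVec, basisMatrix_mulVec]
    rfl
  have hγpos : ∀ i ∈ supp p, 0 < (g + (a : Matrix (Fin r₁) (Fin r₂) ℝ)) i.1 i.2 := by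
    intro i hi
    have := h3 ⟨(i.2, i.1), hi⟩
    rwa [haB] at this
  have hγoff : ∀ i, i ∉ supp p → (g + (a : Matrix (Fin r₁) (Fin r₂) ℝ)) i.1 i.2 = 0 := by
    intro i hi
    rw [Matrix.add_apply, eq_zero_of_notMem_supp (a := g) (i := i) (by rwa [hgs]),
      a.2.1 i.1 i.2 hi, add_zero]
  have hvpos : ∀ i ∈ supp p, 0 < unvec v i.1 i.2 := fun i hi => h2 ⟨(i.2, i.1), hi⟩
  have hsv : supp (unvec v) = supp p := supp_eq_of_pos_of_eq_zero hvpos hoff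
  have hsγ : supp (g + (a : Matrix (Fin r₁) (Fin r₂) ℝ)) = supp p :=
    supp_eq_of_pos_of_eq_zero hγpos hγoff
  refine copulaArray_eq_of_sum_mul_log ?_ (hsγ.trans hsv.symm) (by rwa [hsv]) ?_
  · refine mem_copulaArrays_of_nonneg hr₁ hr₂ (fun i j => ?_) (fun i => ?_) (fun j => ?_)
    · by_cases h : (i, j) ∈ supp p
      · exact (hγpos _ h).le
      · exact (hγoff _ h).ge
    · simp [Finset.sum_add_distrib, hgmem.2.1, a.2.2.1]
    · simp [Finset.sum_add_distrib, hgmem.2.2, a.2.2.2]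
  · rw [hsv]
    intro c hc
    refine forall_transpose_reducedBasisMatrix b
      (f := fun i => Real.log ((g + (a : Matrix (Fin r₁) (Fin r₂) ℝ)) i.1 i.2 / unvec v i.1 i.2))
      ?_ hc
    rw [← sub_eq_zero, ← Matrix.mulVec_sub] at h1
    rw [← h1]
    congr 1
    ext k
    rw [Real.log_div (hγpos _ k.2).ne' (hvpos _ k.2).ne', Pi.sub_apply, selection_mulVec, haB]
    rfl

/-- Arrays supported in `S`, vectorised in Euclidean space. -/
def euclideanSupportedIn (S : Finset (Fin r₁ × Fin r₂)) :
    Set (EuclideanSpace ℝ (Fin r₂ × Fin r₁)) :=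
  {v | ∀ i, i ∉ S → v (i.2, i.1) = 0}

/-- Yule's coefficient of the copula array, as a function of the vectorised probability array. -/
noncomputable def yuleMap (v : EuclideanSpace ℝ (Fin r₂ × Fin r₁)) : ℝ :=
  yule (copulaArray (unvec v.ofLp))

theorem yuleMap_evec (a : Matrix (Fin r₁) (Fin r₂) ℝ) :
    yuleMap (evec a) = yule (copulaArray a) := rfl

/-- The derivative of Yule's coefficient as a function of the vectorised probability array. -/
noncomputable def yuleDeriv (b : Module.Basis (Fin d) ℝ (nullMarginArrays (supp p))) :
    EuclideanSpace ℝ (Fin r₂ × Fin r₁) →L[ℝ] ℝ :=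
  innerSL ℝ (WithLp.toLp 2 (kappa r₁ r₂ • ((copulaJacobian b p)ᵀ *ᵥ rankKron r₁ r₂)))

theorem yuleDeriv_apply (b : Module.Basis (Fin d) ℝ (nullMarginArrays (supp p)))
    (z : EuclideanSpace ℝ (Fin r₂ × Fin r₁)) :
    yuleDeriv b z = kappa r₁ r₂ * (rankKron r₁ r₂ ⬝ᵥ (copulaJacobian b p *ᵥ z.ofLp)) := by
  rw [yuleDeriv, innerSL_apply_apply, EuclideanSpace.inner_eq_star_dotProduct]
  simp only [star_trivial, dotProduct_smul, smul_eq_mul]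
  rw [Matrix.mulVec_transpose, dotProduct_comm, ← Matrix.dotProduct_mulVec]

/-- The derivative is taken only within arrays supported in S, since the local formula for the
copula array is available only there. -/
theorem hasFDerivWithinAt_yuleMap (hr₁ : 0 < r₁) (hr₂ : 0 < r₂)
    (hp : ∀ i ∈ supp p, 0 < p i.1 i.2) (hΓ : (copulaArraysOn (supp p)).Nonempty)
    (b : Module.Basis (Fin d) ℝ (nullMarginArrays (supp p))) :
    HasFDerivWithinAt yuleMap (yuleDeriv b) (euclideanSupportedIn (supp p)) (evec p) := by
  obtain ⟨t, ht0, htd, hteq⟩ := exists_hasFDerivAt_copulaArray_eq hr₁ hr₂ hp hΓ b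
  set e := (EuclideanSpace.equiv (Fin r₂ × Fin r₁) ℝ) with he
  have hte : HasFDerivAt (fun v : EuclideanSpace ℝ (Fin r₂ × Fin r₁) => t v.ofLp) _ (evec p) :=
    HasFDerivAt.comp (evec p) (f := e) (by exact htd) e.hasFDerivAt
  let ℓ : (Fin d → ℝ) →L[ℝ] ℝ := LinearMap.toContinuousLinearMap
    { toFun := fun w => kappa r₁ r₂ * (rankKron r₁ r₂ ⬝ᵥ (basisMatrix b *ᵥ w))
      map_add' := fun x y => by rw [Matrix.mulVec_add, dotProduct_add, mul_add]
      map_smul' := fun c x => by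
        rw [Matrix.mulVec_smul, dotProduct_smul, RingHom.id_apply, smul_eq_mul, smul_eq_mul]
        ring }
  have hℓ : ∀ w, ℓ w = kappa r₁ r₂ * (rankKron r₁ r₂ ⬝ᵥ (basisMatrix b *ᵥ w)) := fun _ => rfl
  have hmain := ((ℓ.hasFDerivAt.comp (evec p) hte).const_add
    (yule (copulaArray p))).hasFDerivWithinAt (s := euclideanSupportedIn (supp p))
  have heq : ∀ᶠ v : EuclideanSpace ℝ (Fin r₂ × Fin r₁) in 𝓝 (evec p),
      v ∈ euclideanSupportedIn (supp p) →
        yuleMap v = yule (copulaArray p) + (ℓ ∘ fun v => t v.ofLp) v := by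
    have : ContinuousAt e (evec p) := e.continuous.continuousAt
    filter_upwards [this.eventually hteq] with v hv hvs
    rw [Function.comp_apply, hℓ, basisMatrix_mulVec, ← yule_add]
    exact congrArg yule (hv hvs)
  refine (hmain.congr_of_eventuallyEq ?_ ?_).congr_fderiv ?_
  · exact eventually_nhdsWithin_iff.2 heq
  · refine heq.self_of_nhds fun i hi => ?_
    exact eq_zero_of_notMem_supp hi
  · ext1 z
    rw [yuleDeriv_apply, copulaJacobian]
    simp only [ContinuousLinearMap.comp_apply, LinearMap.coe_toContinuousLinearMap',
      Matrix.mulVecLin_apply, hℓ, ← Matrix.mulVec_mulVec]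
    rfl

end CopulaMap

/-! ### Convergence in probability and in law, and the delta method. -/

section Convergence

variable {Ω Ω' Ω'' : Type*} [MeasurableSpace Ω] {μ : Measure Ω} [MeasurableSpace Ω']
  {μ' : Measure Ω'} [MeasurableSpace Ω''] {μ'' : Measure Ω''}

/-- Almost surely, a deviation of f(W) by ε forces W out of a δ-ball around x. The limit y need not
equal f x, which allows its use for remainder terms. -/
theorem tendstoInMeasure_comp_of_tendsto_nhdsWithin {E F : Type*} [PseudoMetricSpace E]
    [PseudoMetricSpace F] {f : E → F} {U : Set E} {x : E} {y : F}
    (hf : Tendsto f (𝓝[U] x) (𝓝 y)) {W : ℕ → Ω → E} (hU : ∀ n, ∀ᵐ ω ∂μ, W n ω ∈ U)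
    (hW : TendstoInMeasure μ W atTop fun _ => x) :
    TendstoInMeasure μ (fun n ω => f (W n ω)) atTop fun _ => y := by
  rw [tendstoInMeasure_iff_dist] at hW ⊢
  intro ε hε
  obtain ⟨δ, hδ, h⟩ := Metric.mem_nhdsWithin_iff.1 (hf (Metric.ball_mem_nhds y hε))
  refine tendsto_of_tendsto_of_tendsto_of_le_of_le tendsto_const_nhds (hW δ hδ)
    (fun _ => zero_le) fun n => measure_mono_ae ?_
  filter_upwards [hU n] with ω hω hle
  by_contra hlt
  exact absurd (h ⟨Metric.mem_ball.2 (not_le.1 hlt), hω⟩) (not_lt.2 hle)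

theorem charFun_map_inner_one {E : Type*} [NormedAddCommGroup E] [InnerProductSpace ℝ E]
    [SecondCountableTopology E] [MeasurableSpace E] [BorelSpace E] {X : Ω → E}
    (hX : AEMeasurable X μ) (t : E) :
    charFun (μ.map X) t = charFun (μ.map fun ω => inner ℝ (X ω) t) 1 := by
  have hX' : AEMeasurable (fun ω => inner ℝ (X ω) t) μ := by fun_prop
  rw [charFun_apply, charFun_apply, integral_map hX (by fun_prop), integral_map hX' (by fun_prop)]
  simp

variable [IsProbabilityMeasure μ] [IsProbabilityMeasure μ'] [IsProbabilityMeasure μ'']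

theorem _root_.MeasureTheory.TendstoInDistribution.of_map_eq {E : Type*} [TopologicalSpace E]
    [MeasurableSpace E] [OpensMeasurableSpace E] {X : ℕ → Ω → E} {Z : Ω' → E} {W : Ω'' → E}
    (h : TendstoInDistribution X atTop Z (fun _ => μ) μ') (hW : AEMeasurable W μ'')
    (hZW : μ'.map Z = μ''.map W) : TendstoInDistribution X atTop W (fun _ => μ) μ'' where
  forall_aemeasurable := h.forall_aemeasurable
  aemeasurable_limit := hW
  tendsto := by
    convert h.tendsto using 2
    congr 1
    exact Subtype.ext hZW.symm

/-- Portmanteau on the closed set of points at distance at least ε from c, which is null for the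
limit. -/
theorem _root_.MeasureTheory.TendstoInDistribution.tendstoInMeasure_const {E : Type*}
    [PseudoMetricSpace E] [MeasurableSpace E] [BorelSpace E] {X : ℕ → Ω → E} {c : E}
    (h : TendstoInDistribution X atTop (fun _ => c) (fun _ => μ) μ') :
    TendstoInMeasure μ X atTop fun _ => c := by
  rw [tendstoInMeasure_iff_dist]
  intro ε hε
  have hcl : IsClosed {z : E | ε ≤ dist z c} := isClosed_le continuous_const (by fun_prop)
  have h1 := ProbabilityMeasure.limsup_measure_closed_le_of_tendsto h.tendsto hcl
  have h2 : μ'.map (fun _ => c) {z : E | ε ≤ dist z c} = 0 := by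
    rw [Measure.map_apply measurable_const hcl.measurableSet]
    simp [hε.not_ge]
  refine tendsto_of_le_liminf_of_limsup_le zero_le ?_
  refine le_trans (le_of_eq ?_) (h1.trans h2.le)
  congr 1
  ext n
  exact (Measure.map_apply_of_aemeasurable (h.forall_aemeasurable n) hcl.measurableSet).symm

/-- Multiplying the convergent sequence by the inverse rate, which tends to 0, gives the limit 0 by
Slutsky. -/
theorem tendstoInMeasure_of_rate {E : Type*} [NormedAddCommGroup E] [NormedSpace ℝ E]
    [SecondCountableTopology E] [MeasurableSpace E] [BorelSpace E] {W : ℕ → Ω → E} {x : E}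
    {Z : Ω' → E} {rate : ℕ → ℝ} (hrate : Tendsto rate atTop atTop)
    (hT : TendstoInDistribution (fun n ω => rate n • (W n ω - x)) atTop Z (fun _ => μ) μ') :
    TendstoInMeasure μ W atTop fun _ => x := by
  have hinv : TendstoInMeasure μ (fun n (_ : Ω) => (rate n)⁻¹) atTop fun _ => (0 : ℝ) :=
    tendstoInMeasure_of_tendsto_ae (fun n => aestronglyMeasurable_const)
      (ae_of_all _ fun _ => hrate.inv_tendsto_atTop)
  have h1 := hT.continuous_comp_prodMk_of_tendstoInMeasure_const
    (g := fun z : E × ℝ => z.2 • z.1 + x) (by fun_prop) hinv fun n => aemeasurable_const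
  simp only [zero_smul, zero_add] at h1
  refine h1.tendstoInMeasure_const.congr' ?_ (ae_eq_refl _)
  filter_upwards [hrate.eventually_gt_atTop 0] with n hn
  filter_upwards with ω
  rw [smul_smul, inv_mul_cancel₀ hn.ne', one_smul, sub_add_cancel]

/-- The delta method, for a function differentiable within a set that carries the sequence. -/
theorem delta_method {E : Type*} [NormedAddCommGroup E] [NormedSpace ℝ E]
    [SecondCountableTopology E] [MeasurableSpace E] [BorelSpace E] {φ : E → ℝ} {L : E →L[ℝ] ℝ}
    {U : Set E} {x : E} (hφ : HasFDerivWithinAt φ L U x) {W : ℕ → Ω → E}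
    (hW : ∀ n, AEMeasurable (W n) μ) (hU : ∀ n, ∀ᵐ ω ∂μ, W n ω ∈ U)
    (hφW : ∀ n, AEMeasurable (fun ω => φ (W n ω)) μ) {Z : Ω' → E} {rate : ℕ → ℝ}
    (hrate : Tendsto rate atTop atTop)
    (hT : TendstoInDistribution (fun n ω => rate n • (W n ω - x)) atTop Z (fun _ => μ) μ') :
    TendstoInDistribution (fun n ω => rate n * (φ (W n ω) - φ x)) atTop (fun ω => L (Z ω))
      (fun _ => μ) μ' := by
  have hWx := tendstoInMeasure_of_rate hrate hT
  -- The normalised Taylor remainder; at v = x it is 0, because the inverse of 0 is 0.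
  set ε : E → ℝ := fun v => ‖v - x‖⁻¹ * (φ v - φ x - L (v - x)) with hε
  have hε0 : Tendsto ε (𝓝[U] x) (𝓝 0) := by
    rw [tendsto_zero_iff_norm_tendsto_zero]
    simpa [hε, norm_mul] using hasFDerivWithinAt_iff_tendsto.1 hφ
  have hεW := tendstoInMeasure_comp_of_tendsto_nhdsWithin hε0 hU hWx
  -- The sign of the rate compensates for the absolute value produced by the norm, so that the final
  -- identity holds for every n.
  set s : ℕ → ℝ := fun n => if 0 ≤ rate n then 1 else -1 with hs
  have hs1 : ∀ n, |s n| = 1 := fun n => by simp only [hs]; split_ifs <;> simp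
  have hsr : ∀ n, |rate n| * s n = rate n := fun n => by
    simp only [hs]
    split_ifs with h
    · rw [abs_of_nonneg h, mul_one]
    · rw [abs_of_neg (not_le.1 h)]; ring
  have hY : TendstoInMeasure μ (fun n ω => s n * ε (W n ω)) atTop fun _ => (0 : ℝ) := by
    rw [tendstoInMeasure_iff_norm] at hεW ⊢
    simpa [hs1] using hεW
  have hYm : ∀ n, AEMeasurable (fun ω => s n * ε (W n ω)) μ := by
    intro n
    have h1 := hφW n
    have h2 := (hW n).sub_const x
    have h3 : AEMeasurable (fun ω => L (W n ω - x)) μ := L.continuous.measurable.comp_aemeasurable h2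
    exact ((h2.norm.inv.mul ((h1.sub_const _).sub h3)).const_mul _)
  have h1 := hT.continuous_comp_prodMk_of_tendstoInMeasure_const
    (g := fun z : E × ℝ => L z.1 + ‖z.1‖ * z.2) (by fun_prop) hY hYm
  simp only [mul_zero, add_zero] at h1
  refine h1.congr (fun n => ae_of_all _ fun ω => ?_) (ae_eq_refl _)
  rcases eq_or_ne (W n ω) x with h | h
  · simp [h]
  · have hne : ‖W n ω - x‖ ≠ 0 := norm_ne_zero_iff.2 (sub_ne_zero.2 h)
    calc L (rate n • (W n ω - x)) + ‖rate n • (W n ω - x)‖ * (s n * ε (W n ω))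
        = rate n * L (W n ω - x) + (|rate n| * s n) *
            (‖W n ω - x‖ * ‖W n ω - x‖⁻¹ * (φ (W n ω) - φ x - L (W n ω - x))) := by
          rw [map_smul, norm_smul, Real.norm_eq_abs, smul_eq_mul]
          simp only [hε]
          ring
      _ = rate n * (φ (W n ω) - φ x) := by
          rw [hsr, mul_inv_cancel₀ hne]; ring

/-- Cramér-Wold device. -/
theorem tendstoInDistribution_of_inner {E : Type*} [NormedAddCommGroup E] [InnerProductSpace ℝ E]
    [FiniteDimensional ℝ E] [MeasurableSpace E] [BorelSpace E] {X : ℕ → Ω → E} {Z : Ω' → E}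
    (hX : ∀ n, AEMeasurable (X n) μ) (hZ : AEMeasurable Z μ')
    (h : ∀ t : E, TendstoInDistribution (fun n ω => inner ℝ (X n ω) t) atTop
      (fun ω => inner ℝ (Z ω) t) (fun _ => μ) μ') :
    TendstoInDistribution X atTop Z (fun _ => μ) μ' where
  forall_aemeasurable := hX
  aemeasurable_limit := hZ
  tendsto := by
    refine ProbabilityMeasure.tendsto_iff_tendsto_charFun.2 fun t => ?_
    have h1 := ProbabilityMeasure.tendsto_iff_tendsto_charFun.1 (h t).tendsto 1
    simpa only [ProbabilityMeasure.coe_mk, ← charFun_map_inner_one (hX _), ← charFun_map_inner_one hZ]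
      using h1

end Convergence

/-! ### Empirical arrays and the multinomial central limit theorem. -/

section Empirical

variable {Ω : Type*} [MeasurableSpace Ω] {μ : Measure Ω} {r₁ r₂ : ℕ}
  {x₁ : Fin r₁ → ℝ} {x₂ : Fin r₂ → ℝ} {P : Measure (ℝ × ℝ)}
  {X : ℕ → Ω → ℝ × ℝ}

/-- The empirical array factors through the cell counts, which live in a countable discrete space
where every function is measurable. Hence g is arbitrary, and no measurability of the copula map is
needed. -/
theorem aemeasurable_comp_empiricalArray {F : Type*} [MeasurableSpace F]
    (g : Matrix (Fin r₁) (Fin r₂) ℝ → F) (hX : ∀ k, AEMeasurable (X k) μ) (n : ℕ) :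
    AEMeasurable (fun ω => g (empiricalArray x₁ x₂ X n ω)) μ := by
  classical
  let N : Ω → Fin r₁ × Fin r₂ → ℕ := fun ω i =>
    ∑ k ∈ Finset.range n, if X k ω = (x₁ i.1, x₂ i.2) then 1 else 0
  have hN : AEMeasurable N μ := by
    refine aemeasurable_pi_iff.2 fun i => Finset.aemeasurable_fun_sum _ fun k _ => ?_
    have : Measurable fun z : ℝ × ℝ => if z = (x₁ i.1, x₂ i.2) then (1 : ℕ) else 0 :=
      Measurable.ite (measurableSet_singleton _) measurable_const measurable_const
    exact this.comp_aemeasurable (hX k)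
  have : (fun ω => g (empiricalArray x₁ x₂ X n ω)) = (fun c : Fin r₁ × Fin r₂ → ℕ =>
      g (Matrix.of fun i j => (1 / (n : ℝ)) * (c (i, j) : ℝ))) ∘ N := by
    ext ω
    simp only [Function.comp_apply, empiricalArray, N]
    congr! 5
    simp only [Nat.cast_sum, Nat.cast_ite, Nat.cast_one, Nat.cast_zero]
  rw [this]
  exact (Measurable.of_discrete).comp_aemeasurable hN

/-- Almost surely no observation falls in a cell of probability zero, and the uniform array on S
vanishes off S. -/
theorem ae_evec_smoothedArray_mem [IsFiniteMeasure P] (hX : ∀ k, HasLaw (X k) P μ) (n : ℕ) :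
    ∀ᵐ ω ∂μ, evec (smoothedArray x₁ x₂ (supp (probArray x₁ x₂ P)) X n ω) ∈
      euclideanSupportedIn (supp (probArray x₁ x₂ P)) := by
  have h : ∀ᵐ ω ∂μ, ∀ (k : ℕ) (i : Fin r₁ × Fin r₂), i ∉ supp (probArray x₁ x₂ P) →
      X k ω ≠ (x₁ i.1, x₂ i.2) := by
    refine ae_all_iff.2 fun k => ae_all_iff.2 fun i => ?_
    by_cases hi : i ∈ supp (probArray x₁ x₂ P)
    · exact ae_of_all _ fun _ h => absurd hi h
    · have h0 : P.real {(x₁ i.1, x₂ i.2)} = 0 := eq_zero_of_notMem_supp hi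
      have h1 : ∀ᵐ z ∂P, z ≠ (x₁ i.1, x₂ i.2) := by
        rw [ae_iff]
        simpa using (measureReal_eq_zero_iff).1 h0
      filter_upwards [((hX k).ae_iff (p := fun z => z ≠ (x₁ i.1, x₂ i.2))
        (measurableSet_setOfPred.1 (measurableSet_singleton _).compl)).2 h1] with ω hω _
      exact hω
  filter_upwards [h] with ω hω i hi
  have : empiricalArray x₁ x₂ X n ω i.1 i.2 = 0 := by
    simp only [empiricalArray, Matrix.of_apply]
    rw [Finset.sum_eq_zero fun k _ => if_neg (hω k i hi), mul_zero]
  have hu : uniformArray (supp (probArray x₁ x₂ P)) i.1 i.2 = 0 := if_neg hi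
  change ((n : ℝ) / (n + 1)) * empiricalArray x₁ x₂ X n ω i.1 i.2 +
    (1 / ((n : ℝ) + 1)) * uniformArray (supp (probArray x₁ x₂ P)) i.1 i.2 = 0
  rw [this, hu, mul_zero, mul_zero, add_zero]

/-- The linear statistic with value `t (j, i)` at the grid point `(x₁ i, x₂ j)`. -/
noncomputable def gridStat (x₁ : Fin r₁ → ℝ) (x₂ : Fin r₂ → ℝ) (t : Fin r₂ × Fin r₁ → ℝ)
    (z : ℝ × ℝ) : ℝ :=
  ∑ k, Set.indicator {(x₁ k.2, x₂ k.1)} (fun _ => t k) z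

theorem measurable_gridStat (t : Fin r₂ × Fin r₁ → ℝ) : Measurable (gridStat x₁ x₂ t) :=
  Finset.measurable_fun_sum _ fun _ _ => measurable_const.indicator (measurableSet_singleton _)

theorem abs_gridStat_le (t : Fin r₂ × Fin r₁ → ℝ) (z : ℝ × ℝ) :
    ‖gridStat x₁ x₂ t z‖ ≤ ∑ k, ‖t k‖ :=
  (norm_sum_le _ _).trans (Finset.sum_le_sum fun _ _ => norm_indicator_le_norm_self _ _)

theorem integral_gridStat [IsFiniteMeasure P] (t : Fin r₂ × Fin r₁ → ℝ) :
    ∫ z, gridStat x₁ x₂ t z ∂P = t ⬝ᵥ vec (probArray x₁ x₂ P) := by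
  simp only [gridStat]
  rw [integral_finsetSum _ fun k _ =>
    (integrable_const _).indicator (measurableSet_singleton _)]
  refine Finset.sum_congr rfl fun k _ => ?_
  rw [integral_indicator_const _ (measurableSet_singleton _), smul_eq_mul, mul_comm]
  rfl

/-- The grid points are distinct, so at most one indicator is nonzero and no cross terms arise. -/
theorem gridStat_sq (hx₁ : Function.Injective x₁) (hx₂ : Function.Injective x₂)
    (t : Fin r₂ × Fin r₁ → ℝ) (z : ℝ × ℝ) :
    gridStat x₁ x₂ t z ^ 2 = gridStat x₁ x₂ (fun k => t k ^ 2) z := by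
  by_cases h : ∃ k : Fin r₂ × Fin r₁, z = (x₁ k.2, x₂ k.1)
  · obtain ⟨k, rfl⟩ := h
    have key : ∀ s : Fin r₂ × Fin r₁ → ℝ, gridStat x₁ x₂ s (x₁ k.2, x₂ k.1) = s k := by
      intro s
      rw [gridStat, Finset.sum_eq_single k]
      · simp
      · intro l _ hl
        refine Set.indicator_of_notMem (fun hmem => hl ?_) _
        have := Prod.mk.inj hmem
        exact Prod.ext (hx₂ this.2).symm (hx₁ this.1).symm
      · simp
    rw [key, key]
  · push Not at h
    have key : ∀ s : Fin r₂ × Fin r₁ → ℝ, gridStat x₁ x₂ s z = 0 := fun s =>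
      Finset.sum_eq_zero fun k _ => 
        Set.indicator_of_notMem (s := {(x₁ k.2, x₂ k.1)}) (fun hk => h k hk) _
    rw [key, key]
    norm_num

theorem dotProduct_multinomialCov_mulVec {ι : Type*} [Fintype ι] [DecidableEq ι] (p t : ι → ℝ) :
    t ⬝ᵥ ((diagonal p - vecMulVec p p) *ᵥ t) = (fun k => t k ^ 2) ⬝ᵥ p - (t ⬝ᵥ p) ^ 2 := by
  rw [Matrix.sub_mulVec, dotProduct_sub, Matrix.vecMulVec_mulVec]
  congr 1
  · refine Finset.sum_congr rfl fun k _ => ?_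
    rw [Matrix.mulVec_diagonal]; ring
  · simp only [op_smul_eq_smul, dotProduct_smul, smul_eq_mul, dotProduct_comm p t]
    ring

theorem memLp_gridStat_comp [IsFiniteMeasure μ] (hX : ∀ k, HasLaw (X k) P μ)
    (t : Fin r₂ × Fin r₁ → ℝ) (k : ℕ) :
    MemLp (fun ω => gridStat x₁ x₂ t (X k ω)) 2 μ :=
  MemLp.of_bound ((measurable_gridStat t).comp_aemeasurable (hX k).aemeasurable).aestronglyMeasurable
    _ (ae_of_all _ fun _ => abs_gridStat_le t _)

theorem integral_gridStat_comp [IsFiniteMeasure P] (hX : ∀ k, HasLaw (X k) P μ)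
    (t : Fin r₂ × Fin r₁ → ℝ) (k : ℕ) :
    ∫ ω, gridStat x₁ x₂ t (X k ω) ∂μ = t ⬝ᵥ vec (probArray x₁ x₂ P) := by
  rw [← integral_gridStat, ← (hX k).map_eq,
    integral_map (hX k).aemeasurable (measurable_gridStat t).aestronglyMeasurable]

theorem variance_gridStat_comp [IsProbabilityMeasure μ] [IsFiniteMeasure P]
    (hx₁ : Function.Injective x₁) (hx₂ : Function.Injective x₂)
    (hX : ∀ k, HasLaw (X k) P μ) (t : Fin r₂ × Fin r₁ → ℝ) (k : ℕ) :
    Var[fun ω => gridStat x₁ x₂ t (X k ω); μ] =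
      t ⬝ᵥ ((diagonal (vec (probArray x₁ x₂ P)) -
        vecMulVec (vec (probArray x₁ x₂ P)) (vec (probArray x₁ x₂ P))) *ᵥ t) := by
  rw [variance_eq_sub (memLp_gridStat_comp hX t k), dotProduct_multinomialCov_mulVec,
    integral_gridStat_comp hX]
  congr 1
  rw [← integral_gridStat_comp hX _ k]
  exact integral_congr_ae (ae_of_all _ fun ω => gridStat_sq hx₁ hx₂ t _)

/-- The quadratic form at t is the variance of the linear statistic with weights t. -/
theorem posSemidef_multinomialCov [IsProbabilityMeasure μ] [IsFiniteMeasure P]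
    (hx₁ : Function.Injective x₁) (hx₂ : Function.Injective x₂)
    (hX : ∀ k, HasLaw (X k) P μ) :
    (diagonal (vec (probArray x₁ x₂ P)) -
        vecMulVec (vec (probArray x₁ x₂ P)) (vec (probArray x₁ x₂ P))).PosSemidef := by
  refine Matrix.PosSemidef.of_dotProduct_mulVec_nonneg ?_ fun t => ?_
  · ext k l
    simp [Matrix.diagonal_apply, vecMulVec_apply, mul_comm, eq_comm]
    split_ifs with h <;> simp [h]
  · rw [star_trivial, ← variance_gridStat_comp hx₁ hx₂ hX t 0]
    exact variance_nonneg _ _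

theorem map_inner_multivariateGaussian {ι : Type*} [Fintype ι] [DecidableEq ι] {S : Matrix ι ι ℝ}
    (hS : S.PosSemidef) (t : EuclideanSpace ℝ ι) :
    (multivariateGaussian 0 S).map (fun z => inner ℝ t z) =
      gaussianReal 0 (t.ofLp ⬝ᵥ (S *ᵥ t.ofLp)).toNNReal := by
  have h := IsGaussian.map_eq_gaussianReal (μ := multivariateGaussian 0 S) (innerSL ℝ t)
  have hm : ∫ z, innerSL ℝ t z ∂multivariateGaussian 0 S = 0 := by
    rw [ContinuousLinearMap.integral_comp_id_comm IsGaussian.integrable_id]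
    simp
  have hv : Var[innerSL ℝ t; multivariateGaussian 0 S] = t.ofLp ⬝ᵥ (S *ᵥ t.ofLp) := by
    rw [← covarianceBilin_multivariateGaussian (μ := 0) hS,
      covarianceBilin_apply_eq_cov IsGaussian.memLp_two_id, covariance_self (by fun_prop)]
    rfl
  rw [hm, hv] at h
  exact h

theorem inner_evec_empiricalArray {Ω : Type*} {X : ℕ → Ω → ℝ × ℝ} (n : ℕ) (ω : Ω)
    (t : EuclideanSpace ℝ (Fin r₂ × Fin r₁)) :
    inner ℝ (evec (empiricalArray x₁ x₂ X n ω)) t =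
      (1 / (n : ℝ)) * ∑ k ∈ Finset.range n, gridStat x₁ x₂ t.ofLp (X k ω) := by
  classical
  rw [EuclideanSpace.inner_eq_star_dotProduct]
  simp only [star_trivial, dotProduct, gridStat, evec, Matrix.vec, empiricalArray, Matrix.of_apply]
  rw [Finset.sum_comm, Finset.mul_sum]
  refine Finset.sum_congr rfl fun l _ => ?_
  rw [mul_left_comm, Finset.mul_sum]
  congr 1
  refine Finset.sum_congr rfl fun k _ => ?_
  by_cases h : X k ω = (x₁ l.2, x₂ l.1) <;> simp [h]

theorem evec_add (a c : Matrix (Fin r₁) (Fin r₂) ℝ) : evec (a + c) = evec a + evec c := rfl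

theorem evec_smul (s : ℝ) (a : Matrix (Fin r₁) (Fin r₂) ℝ) : evec (s • a) = s • evec a := rfl

/-- The multivariate central limit theorem for the empirical probability array. -/
theorem tendstoInDistribution_empiricalArray [IsProbabilityMeasure μ] [IsFiniteMeasure P]
    (hx₁ : Function.Injective x₁)
    (hx₂ : Function.Injective x₂) (hX : ∀ k, HasLaw (X k) P μ) (hind : iIndepFun X μ) :
    TendstoInDistribution (fun (n : ℕ) ω =>
        √(n : ℝ) • (evec (empiricalArray x₁ x₂ X n ω) - evec (probArray x₁ x₂ P))) atTop id
      (fun _ => μ) (multivariateGaussian 0 (diagonal (vec (probArray x₁ x₂ P)) -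
        vecMulVec (vec (probArray x₁ x₂ P)) (vec (probArray x₁ x₂ P)))) := by
  refine tendstoInDistribution_of_inner (fun n => aemeasurable_comp_empiricalArray
    (fun a => √(n : ℝ) • (evec a - evec (probArray x₁ x₂ P))) (fun k => (hX k).aemeasurable) n)
    aemeasurable_id fun t => ?_
  -- The projection on t of the Gaussian limit has the same variance as one summand of the real
  -- central limit theorem.
  have hlaw : HasLaw (fun z : EuclideanSpace ℝ (Fin r₂ × Fin r₁) => inner ℝ (id z) t)
      (gaussianReal 0 Var[fun ω => gridStat x₁ x₂ t.ofLp (X 0 ω); μ].toNNReal)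
      (multivariateGaussian 0 (diagonal (vec (probArray x₁ x₂ P)) -
        vecMulVec (vec (probArray x₁ x₂ P)) (vec (probArray x₁ x₂ P)))) := by
    refine ⟨by fun_prop, ?_⟩
    rw [variance_gridStat_comp hx₁ hx₂ hX,
      ← map_inner_multivariateGaussian (posSemidef_multinomialCov hx₁ hx₂ hX)]
    simp only [id, real_inner_comm]
  have hclt := tendstoInDistribution_inv_sqrt_mul_sum_sub (P := μ)
    (X := fun k ω => gridStat x₁ x₂ t.ofLp (X k ω)) hlaw (memLp_gridStat_comp hX _ 0)
    (hind.comp (fun _ => gridStat x₁ x₂ t.ofLp) fun _ => measurable_gridStat _)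
    (fun k => IdentDistrib.comp (f := X k) (g := X 0) (u := gridStat x₁ x₂ t.ofLp)
      ⟨(hX k).aemeasurable, (hX 0).aemeasurable, (hX k).map_eq.trans (hX 0).map_eq.symm⟩
      (measurable_gridStat _))
  refine hclt.congr (fun n => ae_of_all _ fun ω => ?_) (ae_eq_refl _)
  beta_reduce
  rw [real_inner_smul_left, inner_sub_left, inner_evec_empiricalArray, integral_gridStat_comp hX,
    EuclideanSpace.inner_eq_star_dotProduct]
  simp only [star_trivial, evec]
  rcases Nat.eq_zero_or_pos n with rfl | hn
  · simp
  · have h1 : (0 : ℝ) < n := by exact_mod_cast hn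
    have h2 : √(n : ℝ) ≠ 0 := (Real.sqrt_pos.2 h1).ne'
    have h3 : √(n : ℝ) * √(n : ℝ) = n := Real.mul_self_sqrt h1.le
    field_simp
    rw [sq, h3]
end Empirical

/-! ### The asymptotic covariance. -/

section Covariance

variable {r₁ r₂ : ℕ} {p : Matrix (Fin r₁) (Fin r₂) ℝ} {d : ℕ}

theorem transpose_weightedGram {S : Finset (Fin r₁ × Fin r₂)}
    (b : Module.Basis (Fin d) ℝ (nullMarginArrays S)) (v : Fin r₂ × Fin r₁ → ℝ) :
    (weightedGram b v)ᵀ = weightedGram b v := by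
  simp only [weightedGram, Matrix.transpose_mul, Matrix.transpose_transpose,
    Matrix.transpose_nonsing_inv, Matrix.diagonal_transpose, Matrix.mul_assoc]

theorem selection_mul_diagonal_mul_transpose {S : Finset (Fin r₁ × Fin r₂)}
    (v : Fin r₂ × Fin r₁ → ℝ) :
    selection S * diagonal v * (selection S)ᵀ = diagonal (selection S *ᵥ v) := by
  ext k l
  rw [selection_mulVec]
  simp only [selection, Matrix.mul_apply, Matrix.one_apply, Matrix.diagonal_apply,
    Subtype.ext_iff, Matrix.submatrix_apply, Matrix.transpose_apply, id, mul_ite, mul_one, mul_zero,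
    ite_mul, one_mul, zero_mul, Finset.sum_ite_eq, Finset.mem_univ, if_true]
  by_cases h : (k : Fin r₂ × Fin r₁) = l <;> simp [h]

/-- Here diag(Rp)⁻¹ R p is the all-ones vector, and Ãᵀ kills it because null-margin arrays have
total 0. This reflects that rescaling p does not change its I-projection. -/
theorem copulaJacobian_mulVec_vec (hp : ∀ i ∈ supp p, p i.1 i.2 ≠ 0)
    (b : Module.Basis (Fin d) ℝ (nullMarginArrays (supp p))) :
    copulaJacobian b p *ᵥ vec p = 0 := by
  have h1 : (reducedBasisMatrix b)ᵀ *ᵥ (fun _ => (1 : ℝ)) = 0 := by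
    refine transpose_reducedBasisMatrix_mulVec_eq_zero b (f := fun _ => 1) fun a ha => ?_
    have : ∑ i ∈ supp p, a i.1 i.2 * 1 = ∑ i : Fin r₁ × Fin r₂, a i.1 i.2 * 1 :=
      Finset.sum_subset (Finset.subset_univ _) fun i _ hi => by rw [ha.1 i.1 i.2 hi, zero_mul]
    rw [this, Fintype.sum_prod_type]
    simp [ha.2.1]
  have h2 : (diagonal (selection (supp p) *ᵥ vec p))⁻¹ *ᵥ (selection (supp p) *ᵥ vec p) =
      fun _ => (1 : ℝ) := by
    rw [inv_diagonal_selection_mulVec fun k => hp _ k.2, selection_mulVec]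
    ext k
    rw [Matrix.mulVec_diagonal]
    exact inv_mul_cancel₀ (hp _ k.2)
  rw [copulaJacobian, ← Matrix.mulVec_mulVec, ← Matrix.mulVec_mulVec, ← Matrix.mulVec_mulVec, h2,
    h1, Matrix.mulVec_zero]

/-- With D = diag(Rp), the middle factor is D⁻¹ (R diag(p) Rᵀ) D⁻¹ = D⁻¹, which becomes G(p) between
Ãᵀ and Ã. -/
theorem copulaJacobian_mul_diagonal_mul_transpose (hp : ∀ i ∈ supp p, p i.1 i.2 ≠ 0)
    (b : Module.Basis (Fin d) ℝ (nullMarginArrays (supp p))) :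
    copulaJacobian b p * diagonal (vec p) * (copulaJacobian b p)ᵀ = copulaCovariance b p := by
  set D := diagonal (selection (supp p) *ᵥ vec p) with hD
  have hDD : D⁻¹ * D * D⁻¹ = D⁻¹ := by
    rw [hD, inv_diagonal_selection_mulVec fun k => hp _ k.2, selection_mulVec,
      Matrix.diagonal_mul_diagonal, Matrix.diagonal_mul_diagonal]
    congr 1
    ext k
    have hk : vec p k.1 ≠ 0 := hp _ k.2
    rw [inv_mul_cancel₀ hk, one_mul]
  have hDt : (D⁻¹)ᵀ = D⁻¹ := by rw [Matrix.transpose_nonsing_inv, hD, Matrix.diagonal_transpose]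
  have hGt : ((weightedGram b (vec (copulaArray p)))⁻¹)ᵀ =
      (weightedGram b (vec (copulaArray p)))⁻¹ := by
    rw [Matrix.transpose_nonsing_inv, transpose_weightedGram]
  have hR := selection_mul_diagonal_mul_transpose (S := supp p) (vec p)
  rw [← hD] at hR
  set A := basisMatrix b
  set B := reducedBasisMatrix b with hB
  set G := (weightedGram b (vec (copulaArray p)))⁻¹
  set R := selection (supp p)
  calc copulaJacobian b p * diagonal (vec p) * (copulaJacobian b p)ᵀ
      = A * G * Bᵀ * (D⁻¹ * (R * diagonal (vec p) * Rᵀ) * D⁻¹) * B * G * Aᵀ := by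
        rw [copulaJacobian]
        simp only [Matrix.transpose_mul, Matrix.transpose_transpose, Matrix.mul_assoc]
        rw [hDt, hGt]
    _ = A * G * (Bᵀ * D⁻¹ * B) * G * Aᵀ := by
        rw [hR, hDD]
        simp only [Matrix.mul_assoc]
    _ = copulaCovariance b p := rfl

theorem dotProduct_copulaCovariance_mulVec (hp : ∀ i ∈ supp p, p i.1 i.2 ≠ 0)
    (b : Module.Basis (Fin d) ℝ (nullMarginArrays (supp p))) (c : ℝ) (k : Fin r₂ × Fin r₁ → ℝ) :
    (c • ((copulaJacobian b p)ᵀ *ᵥ k)) ⬝ᵥ ((diagonal (vec p) - vecMulVec (vec p) (vec p)) *ᵥ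
      (c • ((copulaJacobian b p)ᵀ *ᵥ k))) = c ^ 2 * (k ⬝ᵥ (copulaCovariance b p *ᵥ k)) := by
  have h0 : ((copulaJacobian b p)ᵀ *ᵥ k) ⬝ᵥ vec p = 0 := by
    rw [Matrix.mulVec_transpose, ← Matrix.dotProduct_mulVec, copulaJacobian_mulVec_vec hp,
      dotProduct_zero]
  rw [Matrix.mulVec_smul, dotProduct_smul, smul_dotProduct, Matrix.sub_mulVec, dotProduct_sub,
    Matrix.vecMulVec_mulVec, op_smul_eq_smul, dotProduct_smul, h0, smul_zero, sub_zero,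
    ← copulaJacobian_mul_diagonal_mul_transpose hp b, ← Matrix.mulVec_mulVec,
    ← Matrix.mulVec_mulVec, Matrix.dotProduct_mulVec k, ← Matrix.mulVec_transpose]
  simp only [smul_eq_mul]
  ring

end Covariance

/-! ### Asymptotic negligibility of the smoothing. -/

section Smoothed

variable {Ω : Type*} [MeasurableSpace Ω] {μ : Measure Ω} [IsProbabilityMeasure μ] {r₁ r₂ : ℕ}
  {x₁ : Fin r₁ → ℝ} {x₂ : Fin r₂ → ℝ} {P : Measure (ℝ × ℝ)} [IsFiniteMeasure P]
  {X : ℕ → Ω → ℝ × ℝ}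

theorem tendsto_natCast_div_add_one : Tendsto (fun n : ℕ => (n : ℝ) / (n + 1)) atTop (𝓝 1) := by
  simpa using tendsto_natCast_div_add_atTop (1 : ℝ)

theorem tendsto_sqrt_div_add_one : Tendsto (fun n : ℕ => √(n : ℝ) / (n + 1)) atTop (𝓝 0) := by
  have h : Tendsto (fun n : ℕ => (√(n : ℝ))⁻¹) atTop (𝓝 0) :=
    (Real.tendsto_sqrt_atTop.comp tendsto_natCast_atTop_atTop).inv_tendsto_atTop
  have h1 := tendsto_natCast_div_add_one.mul h
  rw [mul_zero] at h1
  refine h1.congr fun n => ?_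
  rcases Nat.eq_zero_or_pos n with rfl | hn
  · simp
  · have h2 : (0 : ℝ) < n := by exact_mod_cast hn
    have h3 : √(n : ℝ) ≠ 0 := (Real.sqrt_pos.2 h2).ne'
    have h4 : √(n : ℝ) ^ 2 = n := Real.sq_sqrt h2.le
    field_simp
    exact h4.symm

/-- Smoothing does not change the limiting law of the empirical probability array. -/
theorem tendstoInDistribution_smoothedArray (hx₁ : Function.Injective x₁)
    (hx₂ : Function.Injective x₂) (hX : ∀ k, HasLaw (X k) P μ) (hind : iIndepFun X μ)
    (S : Finset (Fin r₁ × Fin r₂)) :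
    TendstoInDistribution (fun (n : ℕ) ω =>
        √(n : ℝ) • (evec (smoothedArray x₁ x₂ S X n ω) - evec (probArray x₁ x₂ P))) atTop id
      (fun _ => μ) (multivariateGaussian 0 (diagonal (vec (probArray x₁ x₂ P)) -
        vecMulVec (vec (probArray x₁ x₂ P)) (vec (probArray x₁ x₂ P)))) := by
  have h := tendstoInDistribution_empiricalArray hx₁ hx₂ hX hind
  have hY : TendstoInMeasure μ
      (fun (n : ℕ) (_ : Ω) => ((n : ℝ) / (n + 1), √(n : ℝ) / ((n : ℝ) + 1))) atTop
      fun _ => ((1 : ℝ), (0 : ℝ)) :=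
    tendstoInMeasure_of_tendsto_ae (fun n => aestronglyMeasurable_const)
      (ae_of_all _ fun _ => tendsto_natCast_div_add_one.prodMk_nhds tendsto_sqrt_div_add_one)
  -- Slutsky applied to √n(p̂ₙ − p) = (n/(n+1)) √n(pₙ − p) + (√n/(n+1)) (q − p).
  have h1 := h.continuous_comp_prodMk_of_tendstoInMeasure_const
    (g := fun z : EuclideanSpace ℝ (Fin r₂ × Fin r₁) × ℝ × ℝ =>
      z.2.1 • z.1 + z.2.2 • (evec (uniformArray S) - evec (probArray x₁ x₂ P))) (by fun_prop) hY
    fun n => aemeasurable_const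
  simp only [one_smul, zero_smul, add_zero] at h1
  refine h1.congr (fun n => ae_of_all _ fun ω => ?_) (ae_eq_refl _)
  have hn : (n : ℝ) + 1 ≠ 0 := by positivity
  simp only [smoothedArray, evec_add, evec_smul]
  match_scalars <;> field_simp
  ring

end Smoothed

end DiscreteCopula

/-! ### Consistency and limiting laws of Yule's coefficient. -/

theorem mainTheorem6 {Ω : Type*} [MeasurableSpace Ω] (μ : Measure Ω) [IsProbabilityMeasure μ]
    (r₁ r₂ : ℕ) (hr₁ : 2 ≤ r₁) (hr₂ : 2 ≤ r₂)
    (x₁ : Fin r₁ → ℝ) (x₂ : Fin r₂ → ℝ) (hx₁ : StrictMono x₁) (hx₂ : StrictMono x₂)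
    (P : Measure (ℝ × ℝ)) [IsProbabilityMeasure P]
    (hP : ∀ᵐ z ∂P, z ∈ Set.range x₁ ×ˢ Set.range x₂)
    (X : ℕ → Ω → ℝ × ℝ) (hX : ∀ k, HasLaw (X k) P μ)
    (p : Matrix (Fin r₁) (Fin r₂) ℝ) (hp : p = probArray x₁ x₂ P)
    (hΓ : (copulaArraysOn (supp p)).Nonempty)
    (phat : ℕ → Ω → Matrix (Fin r₁) (Fin r₂) ℝ)
    (hphat : phat = fun n ω => smoothedArray x₁ x₂ (supp p) X n ω)
    (Y : ℝ) (hY : Y = yule (copulaArray p))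
    (Yhat : ℕ → Ω → ℝ) (hYhat : Yhat = fun n ω => yule (copulaArray (phat n ω))) :
    -- (a) consistency and strong consistency
    ((TendstoInMeasure μ (fun n ω => evec (phat n ω)) atTop (fun _ => evec p) →
        TendstoInMeasure μ Yhat atTop (fun _ => Y)) ∧
      ((∀ᵐ ω ∂μ, Tendsto (fun n => evec (phat n ω)) atTop (𝓝 (evec p))) →
        ∀ᵐ ω ∂μ, Tendsto (fun n => Yhat n ω) atTop (𝓝 Y))) ∧
    (1 ≤ Module.finrank ℝ (nullMarginArrays (supp p)) →
      ∀ b : Module.Basis (Fin (Module.finrank ℝ (nullMarginArrays (supp p)))) ℝ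
          (nullMarginArrays (supp p)),
        -- (b) limiting law at a general rate
        (∀ {Ω' : Type*} [MeasurableSpace Ω'] (μ' : Measure Ω') [IsProbabilityMeasure μ']
            (Z : Ω' → EuclideanSpace ℝ (Fin r₂ × Fin r₁)) (rate : ℕ → ℝ),
          Tendsto rate atTop atTop →
          TendstoInDistribution (fun n ω => rate n • (evec (phat n ω) - evec p)) atTop Z
            (fun _ => μ) μ' →
          TendstoInDistribution (fun n ω => rate n * (Yhat n ω - Y)) atTop
            (fun ω' => kappa r₁ r₂ *
              (rankKron r₁ r₂ ⬝ᵥ (copulaJacobian b p *ᵥ (Z ω').ofLp)))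
            (fun _ => μ) μ') ∧
        -- (c) asymptotic normality under i.i.d. sampling
        (iIndepFun X μ →
          TendstoInDistribution (fun (n : ℕ) ω => √(n : ℝ) • (evec (phat n ω) - evec p)) atTop id
            (fun _ => μ) (multivariateGaussian 0 (diagonal (vec p) - vecMulVec (vec p) (vec p))) ∧
          0 ≤ kappa r₁ r₂ ^ 2 * (rankKron r₁ r₂ ⬝ᵥ (copulaCovariance b p *ᵥ rankKron r₁ r₂)) ∧
          TendstoInDistribution (fun (n : ℕ) ω => √(n : ℝ) * (Yhat n ω - Y)) atTop id
            (fun _ => μ)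
            (gaussianReal 0 (kappa r₁ r₂ ^ 2 *
              (rankKron r₁ r₂ ⬝ᵥ (copulaCovariance b p *ᵥ rankKron r₁ r₂))).toNNReal))) := by
  have h₁ : 0 < r₁ := by omega
  have h₂ : 0 < r₂ := by omega
  have hppos : ∀ i ∈ supp p, 0 < p i.1 i.2 := fun i hi =>
    lt_of_le_of_ne (by rw [hp]; exact measureReal_nonneg) (Ne.symm (mem_supp.1 hi))
  have hU : ∀ n, ∀ᵐ ω ∂μ, evec (phat n ω) ∈ euclideanSupportedIn (supp p) := by
    subst hphat hp
    exact ae_evec_smoothedArray_mem hX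
  have hphat_meas : ∀ {F : Type} [MeasurableSpace F] (g : Matrix (Fin r₁) (Fin r₂) ℝ → F) (n : ℕ),
      AEMeasurable (fun ω => g (phat n ω)) μ := by
    intro F _ g n
    subst hphat
    exact aemeasurable_comp_empiricalArray
      (fun a => g (((n : ℝ) / (n + 1)) • a + (1 / ((n : ℝ) + 1)) • uniformArray (supp p)))
      (fun k => (hX k).aemeasurable) n
  subst hY hYhat
  simp only [← yuleMap_evec]
  -- Continuity follows from differentiability with an auxiliary basis, which may be empty, so part
  -- (a) also covers Δ°(S) = 0.
  have hcont : Tendsto yuleMap (𝓝[euclideanSupportedIn (supp p)] (evec p)) (𝓝 (yuleMap (evec p))) :=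
    (hasFDerivWithinAt_yuleMap h₁ h₂ hppos hΓ
      (Module.finBasis ℝ (nullMarginArrays (supp p)))).continuousWithinAt
  refine ⟨⟨fun h => tendstoInMeasure_comp_of_tendsto_nhdsWithin hcont hU h, fun h => ?_⟩,
    fun _ b => ?_⟩
  · filter_upwards [h, ae_all_iff.2 hU] with ω hω hmem
    exact hcont.comp (tendsto_nhdsWithin_iff.2 ⟨hω, Eventually.of_forall hmem⟩)
  have hφ := hasFDerivWithinAt_yuleMap h₁ h₂ hppos hΓ b
  refine ⟨fun μ' _ Z rate hrate hT => ?_, fun hind => ?_⟩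
  · simpa only [yuleDeriv_apply] using delta_method hφ (fun n => hphat_meas evec n) hU
      (fun n => hphat_meas (fun a => yuleMap (evec a)) n) hrate hT
  have hS : (diagonal (vec p) - vecMulVec (vec p) (vec p)).PosSemidef := by
    rw [hp]
    exact posSemidef_multinomialCov hx₁.injective hx₂.injective hX
  have hclt : TendstoInDistribution (fun (n : ℕ) ω => √(n : ℝ) • (evec (phat n ω) - evec p)) atTop
      id (fun _ => μ) (multivariateGaussian 0 (diagonal (vec p) - vecMulVec (vec p) (vec p))) := by
    rw [hphat]
    have := tendstoInDistribution_smoothedArray hx₁.injective hx₂.injective hX hind (supp p)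
    rwa [← hp] at this
  have hvar := dotProduct_copulaCovariance_mulVec (fun i hi => (hppos i hi).ne') b (kappa r₁ r₂)
    (rankKron r₁ r₂)
  refine ⟨hclt, ?_, ?_⟩
  · rw [← hvar]
    simpa using hS.dotProduct_mulVec_nonneg
      (kappa r₁ r₂ • ((copulaJacobian b p)ᵀ *ᵥ rankKron r₁ r₂))
  -- The limit is the inner product of the Gaussian vector with κ Jᵀk, a centred normal variable
  -- whose variance is identified by `hvar`.
  · refine (delta_method hφ (fun n => hphat_meas evec n) hU
      (fun n => hphat_meas (fun a => yuleMap (evec a)) n)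
      (Real.tendsto_sqrt_atTop.comp tendsto_natCast_atTop_atTop) hclt).of_map_eq aemeasurable_id ?_
    rw [Measure.map_id, ← hvar]
    exact map_inner_multivariateGaussian hS _
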